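/- Let $n\ge 1$ be an integer. For a random variable $X$ with values in $\mathbb{R}^k$ that has a probability density $p$ with respect to the measure $\mathrm{d}^kx/(2\pi)^{k/2}$, let $S(X)=-\mathbb{E}\ln p(X)$ be its Shannon differential entropy. Let $\mathbf{B}^0=(B_1^0,B_2^0,B_3^0)$ be the triple of $n\times 2n$ real matrices $$B_1^0=\begin{pmatrix} I_n & 0\end{pmatrix},\qquad B_2^0=\begin{pmatrix}0& I_n\end{pmatrix},\qquad B_3^0=\begin{pmatrix} I_n& I_n\end{pmatrix}.$$ For $\mathbf{p}\in\mathbb{R}_{\ge0}^3$ let $$f(\mathbf{B}^0,\mathbf{p})=\sup_X\Big(S(X)-\sum_{i=1}^3p_i\,S(B_i^0X)\Big)\in(-\infty,\infty],$$ where the supremum is over all random variables $X$ with values in $\mathbb{R}^{2n}$ and finite Shannon differential entropy for which $\sum_i p_i\,S(B_i^0X)$ is well defined in $[-\infty,\infty]$ (terms with $p_i=0$ being omitted). For $\mathbf{s}\in\mathbb{R}^3$ let $$\phi_{\mathbf{B}^0}(\mathbf{s})=\inf\big\{\mathbf{p}\cdot\mathbf{s}+f(\mathbf{B}^0,\mathbf{p})\;:\;\mathbf{p}\in\mathbb{R}_{\ge0}^3,\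 2n=n\,(p_1+p_2+p_3)\big\}.$$ Then for every $\mathbf{s}\in\mathbb{R}^3$, with $a_i=\mathrm{e}^{2s_i/n}$, the following holds. If $$a_1<a_2+a_3,\qquad a_2<a_1+a_3,\qquad a_3<a_1+a_2,$$ then $$\phi_{\mathbf{B}^0}(\mathbf{s})=\frac n2\ln\frac{(a_2+a_3-a_1)\,a_1+(a_1+a_3-a_2)\,a_2+(a_1+a_2-a_3)\,a_3}{4};$$ otherwise $$\phi_{\mathbf{B}^0}(\mathbf{s})=\min(s_1+s_2,\;s_1+s_3,\;s_2+s_3).$$ -/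

import Mathlib

open MeasureTheory
open scoped ENNReal

noncomputable section

namespace BrascampLieb

/-- The reference measure `dx / (2π)^(n/2)` on `ℝ^ι`, where `n` is the cardinality of `ι`. -/
def refMeasure (ι : Type) [Fintype ι] : Measure (ι → ℝ) :=
  ENNReal.ofReal ((2 * Real.pi) ^ (-(Fintype.card ι : ℝ) / 2)) • volume

/-- `ln p(x)`, where `p` is the density of the law `μ` with respect to the reference measure. -/
def logDensity {ι : Type} [Fintype ι] (μ : Measure (ι → ℝ)) (x : ι → ℝ) : ℝ :=
  Real.log (μ.rnDeriv (refMeasure ι) x).toReal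

/-- The expectation of the positive part of `-ln p(X)`, where `X` has law `μ` and density `p`. -/
def entropyPos {ι : Type} [Fintype ι] (μ : Measure (ι → ℝ)) : ℝ≥0∞ :=
  ∫⁻ x, ENNReal.ofReal (-logDensity μ x) ∂μ

/-- The expectation of the negative part of `-ln p(X)`, where `X` has law `μ` and density `p`. -/
def entropyNeg {ι : Type} [Fintype ι] (μ : Measure (ι → ℝ)) : ℝ≥0∞ :=
  ∫⁻ x, ENNReal.ofReal (logDensity μ x) ∂μ

/-- The law `μ` has a density `p` and the expectation `-𝔼 ln p(X)` exists in `[-∞, ∞]`. -/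
def HasEntropy {ι : Type} [Fintype ι] (μ : Measure (ι → ℝ)) : Prop :=
  μ ≪ volume ∧ (entropyPos μ ≠ ⊤ ∨ entropyNeg μ ≠ ⊤)

/-- The law `μ` has a density `p` and `ln p(X)` is integrable: the entropy is finite. -/
def HasFiniteEntropy {ι : Type} [Fintype ι] (μ : Measure (ι → ℝ)) : Prop :=
  μ ≪ volume ∧ entropyPos μ ≠ ⊤ ∧ entropyNeg μ ≠ ⊤

/-- The Shannon differential entropy `S(X) = -𝔼 ln p(X) ∈ [-∞, ∞]` of a random variable `X`
with law `μ`; it is meaningful when `HasEntropy μ`. -/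
def shannonEntropy {ι : Type} [Fintype ι] (μ : Measure (ι → ℝ)) : EReal :=
  (entropyPos μ : EReal) - (entropyNeg μ : EReal)

/-- A Brascamp--Lieb datum on `ℝ^ι`: matrices `B₁, …, B_K`, where `Bᵢ` has `d i` rows and
rank `d i`. -/
structure Datum (ι : Type) [Fintype ι] (K : ℕ) (d : Fin K → ℕ) where
  B : (i : Fin K) → Matrix (Fin (d i)) ι ℝ
  rank_eq : ∀ i, (B i).rank = d i

/-- The law of `Bᵢ X`, where `X` has law `μ`. -/
def Datum.outputLaw {ι : Type} [Fintype ι] {K : ℕ} {d : Fin K → ℕ} (D : Datum ι K d)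
    (μ : Measure (ι → ℝ)) (i : Fin K) : Measure (Fin (d i) → ℝ) :=
  μ.map (fun x => (D.B i).mulVec x)

/-- The extended real number `∑ᵢ pᵢ S(Bᵢ X)` makes sense: the entropies with nonzero coefficients
exist in `[-∞, ∞]`, and `+∞` and `-∞` do not occur together among them. -/
def Datum.WellDefined {ι : Type} [Fintype ι] {K : ℕ} {d : Fin K → ℕ} (D : Datum ι K d)
    (p : Fin K → ℝ) (μ : Measure (ι → ℝ)) : Prop :=
  (∀ i, p i ≠ 0 → HasEntropy (D.outputLaw μ i)) ∧
    ¬ ∃ i j, p i ≠ 0 ∧ p j ≠ 0 ∧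
      shannonEntropy (D.outputLaw μ i) = ⊤ ∧ shannonEntropy (D.outputLaw μ j) = ⊥

/-- The Brascamp--Lieb constant `f(B, p) = sup_X (S(X) - ∑ᵢ pᵢ S(Bᵢ X))`, where `X` ranges over
the random variables with finite Shannon differential entropy for which the expression makes
sense (with the convention `0 · (±∞) = 0`). -/
def Datum.constant {ι : Type} [Fintype ι] {K : ℕ} {d : Fin K → ℕ} (D : Datum ι K d)
    (p : Fin K → ℝ) : EReal :=
  ⨆ μ ∈ {μ : Measure (ι → ℝ) |
      IsProbabilityMeasure μ ∧ HasFiniteEntropy μ ∧ D.WellDefined p μ},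
    (shannonEntropy μ - ∑ i, (p i : EReal) * shannonEntropy (D.outputLaw μ i))

/-- The optimized bound
`φ_B(s) = inf {p · s + f(B, p) : p ∈ ℝ_{≥0}^K, n = p · (n₁, …, n_K)}`. -/
def Datum.phi {ι : Type} [Fintype ι] {K : ℕ} {d : Fin K → ℕ} (D : Datum ι K d)
    (s : Fin K → ℝ) : EReal :=
  ⨅ p ∈ {p : Fin K → ℝ | (∀ i, 0 ≤ p i) ∧ (Fintype.card ι : ℝ) = ∑ i, p i * (d i : ℝ)},
    (((∑ i, p i * s i : ℝ) : EReal) + D.constant p)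

theorem rank_eq_of_mul_eq_one {n : ℕ} {ι : Type} [Fintype ι] (M : Matrix (Fin n) ι ℝ)
    (N : Matrix ι (Fin n) ℝ) (h : M * N = 1) : M.rank = n := by
  apply le_antisymm
  · simpa using M.rank_le_card_height
  · have h1 := Matrix.rank_mul_le_left M N
    rw [h, Matrix.rank_one] at h1
    simpa using h1

/-- The datum `B₁⁰ = (I 0)`, `B₂⁰ = (0 I)`, `B₃⁰ = (I I)` on `ℝ^n × ℝ^n`. -/
def datumZero (n : ℕ) : Datum (Fin n ⊕ Fin n) 3 (fun _ => n) where
  B := ![Matrix.fromCols 1 0, Matrix.fromCols 0 1, Matrix.fromCols 1 1]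
  rank_eq := by
    intro i
    fin_cases i
    · exact rank_eq_of_mul_eq_one _ (Matrix.fromRows 1 0) (by simp [Matrix.fromCols_mul_fromRows])
    · exact rank_eq_of_mul_eq_one _ (Matrix.fromRows 0 1) (by simp [Matrix.fromCols_mul_fromRows])
    · exact rank_eq_of_mul_eq_one _ (Matrix.fromRows 1 0) (by simp [Matrix.fromCols_mul_fromRows])

/-- The strict triangle inequalities among `a`, `b`, `c`. -/
def StrictTriangle (a b c : ℝ) : Prop :=
  a < b + c ∧ b < a + c ∧ c < a + b

end BrascampLieb

end

/-! Both bounds on `phi` come from Gaussians. For the lower bound, take X centred Gaussian with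
covariance ((α, γ), (γ, β)) ⊗ I_n. Its outputs have variances α, β, α + β + 2γ in each coordinate.
If these are at most a₁, a₂, a₃, then every admissible p gives p · s + f(p) ≥ (n/2) ln(αβ - γ²): the
constraint ∑ pᵢ = 2 cancels the additive constants in the entropies, so the bound does not depend on
p (`le_phi_datumZero`). For the upper bound, an inequality ∫ ∏ fᵢ(Bᵢx)^pᵢ ≤ e^C ∏ (∫ fᵢ)^pᵢ yields
f(p) ≤ C when applied to the output densities (`Datum.constant_le`). Here this is Young's
inequality, proved on the line by transport to Gaussians (`hasYoungBound_real`) and tensorised to ℝⁿ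
(`HasYoungBound.pi_fin`). Under the strict triangle inequalities one covariance has output variances
exactly aᵢ. Its inverse is a positive combination of the bᵢbᵢᵀ, with b₁ = (1, 0), b₂ = (0, 1), b₃ =
(1, 1); the weights determine sharp Young exponents, and the two bounds agree. Otherwise the
exponents degenerate to a permutation of (1, 1, 0), where Young's inequality is just Fubini and
translation invariance. The bounds then meet at a Gaussian whose two outputs with the smaller aᵢ are
independent. -/

namespace BrascampLieb

open Filter Topology Set

/-! ### Monotone transport on the line and its combination into a map of the plane -/

section Transport

/-- The distribution function of a continuous integrable function has that function as its
derivative. -/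
theorem hasDerivAt_integral_Iic {f : ℝ → ℝ} (hf : Continuous f) (hi : Integrable f) (x : ℝ) :
    HasDerivAt (fun t => ∫ u in Iic t, f u) (f x) x := by
  have h1 : (fun t => ∫ u in Iic t, f u) =
      fun t => (∫ u in Iic 0, f u) + ∫ u in (0 : ℝ)..t, f u := by
    ext t
    rw [← intervalIntegral.integral_Iic_sub_Iic hi.integrableOn hi.integrableOn]
    ring
  rw [h1]
  exact (intervalIntegral.integral_hasDerivAt_right (hf.intervalIntegrable _ _)
    hf.stronglyMeasurable.stronglyMeasurableAtFilter hf.continuousAt).const_add _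

theorem strictMono_integral_Iic {f : ℝ → ℝ} (hf : Continuous f) (hi : Integrable f)
    (hpos : ∀ x, 0 < f x) : StrictMono (fun t => ∫ u in Iic t, f u) := by
  apply strictMono_of_deriv_pos
  intro x
  rw [(hasDerivAt_integral_Iic hf hi x).deriv]
  exact hpos x

theorem tendsto_integral_Iic_atTop {f : ℝ → ℝ} (hi : Integrable f) :
    Tendsto (fun t => ∫ u in Iic t, f u) atTop (𝓝 (∫ u, f u)) :=
  (aecover_Iic (μ := volume) tendsto_id).integral_tendsto_of_countably_generated hi

theorem tendsto_integral_Iic_atBot {f : ℝ → ℝ} (hi : Integrable f) :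
    Tendsto (fun t => ∫ u in Iic t, f u) atBot (𝓝 0) := by
  have h2 : Tendsto (fun t : ℝ => ∫ u in Ioi t, f u) atBot (𝓝 (∫ u, f u)) :=
    (aecover_Ioi (μ := volume) tendsto_id).integral_tendsto_of_countably_generated hi
  have h3 := (tendsto_const_nhds (x := ∫ u, f u)).sub h2
  rw [sub_self] at h3
  refine h3.congr fun t => ?_
  rw [← intervalIntegral.integral_Iic_add_Ioi (b := t) hi.integrableOn hi.integrableOn]
  ring

/-- Positivity of `f` puts its distribution function strictly between 0 and the total mass, which
are the limits of that of `g`; the intermediate value theorem does the rest. -/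
theorem exists_integral_Iic_eq {f g : ℝ → ℝ} (hf : Continuous f) (hg : Continuous g)
    (hfi : Integrable f) (hgi : Integrable g) (hf0 : ∀ x, 0 < f x)
    (h : ∫ u, f u = ∫ u, g u) (x : ℝ) : ∃ y, ∫ u in Iic y, g u = ∫ u in Iic x, f u := by
  have hm := strictMono_integral_Iic hf hfi hf0
  have hlo : 0 < ∫ u in Iic x, f u :=
    (setIntegral_nonneg measurableSet_Iic fun u _ => (hf0 u).le).trans_lt (hm (sub_one_lt x))
  have hhi : ∫ u in Iic x, f u < ∫ u, g u := by
    rw [← h]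
    exact (hm (lt_add_one x)).trans_le
      (setIntegral_le_integral hfi (Eventually.of_forall fun u => (hf0 u).le))
  have hc : Continuous (fun t => ∫ u in Iic t, g u) :=
    continuous_iff_continuousAt.2 fun t => (hasDerivAt_integral_Iic hg hgi t).continuousAt
  obtain ⟨b, hb⟩ := ((tendsto_integral_Iic_atBot hgi).eventually_lt_const hlo).exists
  obtain ⟨t, ht⟩ := ((tendsto_integral_Iic_atTop hgi).eventually_const_lt hhi).exists
  exact mem_range_of_exists_le_of_exists_ge hc ⟨b, hb.le⟩ ⟨t, ht.le⟩

/-- Monotone transport between two continuous positive densities on the line. -/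
theorem exists_transport {f g : ℝ → ℝ} (hf : Continuous f) (hg : Continuous g)
    (hfi : Integrable f) (hgi : Integrable g) (hf0 : ∀ x, 0 < f x) (hg0 : ∀ x, 0 < g x)
    (h : ∫ u, f u = ∫ u, g u) :
    ∃ T : ℝ → ℝ, StrictMono T ∧ ∀ x, HasDerivAt T (f x / g (T x)) x := by
  choose T hT using exists_integral_Iic_eq hf hg hfi hgi hf0 h
  have hmf := strictMono_integral_Iic hf hfi hf0
  have hmg := strictMono_integral_Iic hg hgi hg0
  have hmono : StrictMono T := by
    intro x y hxy
    apply hmg.lt_iff_lt.1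
    simp only [hT]
    exact hmf hxy
  have hsurj : Function.Surjective T := by
    intro y
    obtain ⟨x, hx⟩ := exists_integral_Iic_eq hg hf hgi hfi hg0 h.symm y
    exact ⟨x, hmg.injective ((hT x).trans hx)⟩
  -- Continuity keeps T y near T x, where T is the local inverse of the distribution function of `g`
  -- composed with that of `f`; this gives the derivative.
  have hcont : Continuous T := hmono.monotone.continuous_of_surjective hsurj
  refine ⟨T, hmono, fun x => ?_⟩
  have hG : HasStrictDerivAt (fun t => ∫ u in Iic t, g u) (g (T x)) (T x) :=
    hasStrictDerivAt_of_hasDerivAt_of_continuousAt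
      (Eventually.of_forall fun y => hasDerivAt_integral_Iic hg hgi y) hg.continuousAt
  have hne := (hg0 (T x)).ne'
  have hL := (hG.to_localInverse hne).hasDerivAt
  have hE := hG.eventually_left_inverse hne
  have hL' : HasDerivAt (hG.localInverse _ _ _ hne) (g (T x))⁻¹ (∫ u in Iic x, f u) := by
    rw [← hT x]; exact hL
  have hcomp := hL'.comp x (hasDerivAt_integral_Iic hf hfi x)
  rw [mul_comm, ← div_eq_mul_inv] at hcomp
  refine hcomp.congr_of_eventuallyEq ?_
  filter_upwards [hcont.continuousAt.eventually hE] with y hy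
  simp only [Function.comp, ← hT y, hy]

/-- Weighted AM-GM for the products xy, xz, yz with weights ab/e, ac/e, bc/e, where e = ab + ac +
bc. The right side is the Jacobian determinant of `jointTransport`. -/
theorem rpow_mul_rpow_mul_rpow_le {a b c : ℝ} (ha : 0 < a) (hb : 0 < b) (hc : 0 < c)
    {x y z : ℝ} (hx : 0 < x) (hy : 0 < y) (hz : 0 < z) :
    x ^ (a * (b + c) / (a * b + a * c + b * c)) * y ^ (b * (a + c) / (a * b + a * c + b * c)) *
      z ^ (c * (a + b) / (a * b + a * c + b * c)) ≤
      (a * b * (x * y) + a * c * (x * z) + b * c * (y * z)) / (a * b + a * c + b * c) := by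
  set e := a * b + a * c + b * c with he
  have hE : 0 < e := by positivity
  have h := Real.geom_mean_le_arith_mean3_weighted (w₁ := a * b / e) (w₂ := a * c / e)
    (w₃ := b * c / e) (p₁ := x * y) (p₂ := x * z) (p₃ := y * z) (by positivity) (by positivity)
    (by positivity) (by positivity) (by positivity) (by positivity)
    (by rw [← add_div, ← add_div, div_self hE.ne'])
  rw [Real.mul_rpow hx.le hy.le, Real.mul_rpow hx.le hz.le, Real.mul_rpow hy.le hz.le] at h
  have h1 : a * (b + c) / e = a * b / e + a * c / e := by ring
  have h2 : b * (a + c) / e = a * b / e + b * c / e := by ring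
  have h3 : c * (a + b) / e = a * c / e + b * c / e := by ring
  rw [h1, h2, h3, Real.rpow_add hx, Real.rpow_add hy, Real.rpow_add hz]
  calc _ = x ^ (a * b / e) * y ^ (a * b / e) * (x ^ (a * c / e) * z ^ (a * c / e)) *
        (y ^ (b * c / e) * z ^ (b * c / e)) := by ring
    _ ≤ _ := h
    _ = _ := by ring

/-- The map `x ↦ Σ ∑ cᵢ Tᵢ(bᵢ x) bᵢ`, where `Σ⁻¹ = ∑ cᵢ bᵢ bᵢᵀ`, `b₁ = (1, 0)`, `b₂ = (0, 1)`
and `b₃ = (1, 1)`. -/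
noncomputable def jointTransport (a b c : ℝ) (T U V : ℝ → ℝ) (z : ℝ × ℝ) : ℝ × ℝ :=
  ((a * (b + c) * T z.1 + b * c * (V (z.1 + z.2) - U z.2)) / (a * b + a * c + b * c),
    (b * (a + c) * U z.2 + a * c * (V (z.1 + z.2) - T z.1)) / (a * b + a * c + b * c))

/-- Pairing Σ⁻¹ times the difference of two images with the displacement gives a sum of three terms
(W s - W t)(s - t) with positive weights. If the images agree, each term vanishes, and strict
monotonicity identifies the points. -/
theorem jointTransport_injective {a b c : ℝ} (ha : 0 < a) (hb : 0 < b) (hc : 0 < c)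
    {T U V : ℝ → ℝ} (hT : StrictMono T) (hU : StrictMono U) (hV : StrictMono V) :
    Function.Injective (jointTransport a b c T U V) := by
  have aux : ∀ {W : ℝ → ℝ}, StrictMono W → ∀ s t, 0 ≤ (W s - W t) * (s - t) ∧
      ((W s - W t) * (s - t) = 0 → s = t) := by
    intro W hW s t
    rcases lt_trichotomy s t with h | h | h
    · have := mul_pos_of_neg_of_neg (sub_neg.2 (hW h)) (sub_neg.2 h)
      exact ⟨this.le, fun h0 => absurd h0 this.ne'⟩
    · simp [h]
    · have := mul_pos (sub_pos.2 (hW h)) (sub_pos.2 h)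
      exact ⟨this.le, fun h0 => absurd h0 this.ne'⟩
  rintro ⟨x, y⟩ ⟨x', y'⟩ h
  have hE : 0 < a * b + a * c + b * c := by positivity
  simp only [jointTransport, Prod.mk.injEq, div_left_inj' hE.ne'] at h
  obtain ⟨h1, h2⟩ := h
  obtain ⟨hT0, hT1⟩ := aux hT x x'
  obtain ⟨hU0, hU1⟩ := aux hU y y'
  obtain ⟨hV0, hV1⟩ := aux hV (x + y) (x' + y')
  have key : (a * b + a * c + b * c) * (a * ((T x - T x') * (x - x')) +
      b * ((U y - U y') * (y - y')) +
      c * ((V (x + y) - V (x' + y')) * (x + y - (x' + y')))) = 0 := by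
    -- The coefficients are the entries of Σ⁻¹ = ((a + c, c), (c, b + c)) applied to the
    -- displacement.
    linear_combination ((a + c) * (x - x') + c * (y - y')) * h1 +
      (c * (x - x') + (b + c) * (y - y')) * h2
  have key' := (mul_eq_zero.1 key).resolve_left hE.ne'
  have e1 : (T x - T x') * (x - x') = 0 := by nlinarith
  have e2 : (U y - U y') * (y - y') = 0 := by nlinarith
  rw [Prod.mk.injEq]
  exact ⟨hT1 e1, hU1 e2⟩

theorem hasFDerivAt_jointTransport {a b c : ℝ} {T U V : ℝ → ℝ} {z : ℝ × ℝ} {t u v : ℝ}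
    (hT : HasDerivAt T t z.1) (hU : HasDerivAt U u z.2) (hV : HasDerivAt V v (z.1 + z.2)) :
    HasFDerivAt (jointTransport a b c T U V)
      (Matrix.toLin (Module.Basis.finTwoProd ℝ) (Module.Basis.finTwoProd ℝ)
        !![(a * (b + c) * t + b * c * v) / (a * b + a * c + b * c),
            b * c * (v - u) / (a * b + a * c + b * c);
          a * c * (v - t) / (a * b + a * c + b * c),
            (b * (a + c) * u + a * c * v) / (a * b + a * c + b * c)]).toContinuousLinearMap z := by
  have h1 : HasFDerivAt (fun z : ℝ × ℝ => T z.1)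
      (t • ContinuousLinearMap.fst ℝ ℝ ℝ) z := hT.comp_hasFDerivAt z hasFDerivAt_fst
  have h2 : HasFDerivAt (fun z : ℝ × ℝ => U z.2)
      (u • ContinuousLinearMap.snd ℝ ℝ ℝ) z := hU.comp_hasFDerivAt z hasFDerivAt_snd
  have h3 : HasFDerivAt (fun z : ℝ × ℝ => V (z.1 + z.2))
      (v • (ContinuousLinearMap.fst ℝ ℝ ℝ + ContinuousLinearMap.snd ℝ ℝ ℝ)) z :=
    hV.comp_hasFDerivAt z (hasFDerivAt_fst.add hasFDerivAt_snd)
  rw [Matrix.toLin_finTwoProd_toContinuousLinearMap]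
  have h4 := ((h1.const_mul (a * (b + c))).add ((h3.sub h2).const_mul (b * c))).mul_const
    (a * b + a * c + b * c)⁻¹
  have h5 := ((h2.const_mul (b * (a + c))).add ((h3.sub h1).const_mul (a * c))).mul_const
    (a * b + a * c + b * c)⁻¹
  have h6 := h4.prodMk h5
  simp only [← div_eq_mul_inv] at h6
  refine (h6.congr_fderiv ?_)
  ext <;> simp <;> ring

/-- This is Cauchy-Binet: the matrix is Σ times a t b₁b₁ᵀ + b u b₂b₂ᵀ + c v b₃b₃ᵀ, every 2 × 2 minor
of (b₁, b₂, b₃) is ±1, and det Σ = 1/e. -/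
theorem det_jointTransport {a b c : ℝ} (ha : 0 < a) (hb : 0 < b) (hc : 0 < c) (t u v : ℝ) :
    (Matrix.toLin (Module.Basis.finTwoProd ℝ) (Module.Basis.finTwoProd ℝ)
        !![(a * (b + c) * t + b * c * v) / (a * b + a * c + b * c),
            b * c * (v - u) / (a * b + a * c + b * c);
          a * c * (v - t) / (a * b + a * c + b * c),
            (b * (a + c) * u + a * c * v) /
              (a * b + a * c + b * c)]).toContinuousLinearMap.det =
      (a * b * (t * u) + a * c * (t * v) + b * c * (u * v)) / (a * b + a * c + b * c) := by
  have hE : a * b + a * c + b * c ≠ 0 := by positivity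
  rw [LinearMap.det_toContinuousLinearMap, LinearMap.det_toLin, Matrix.det_fin_two_of]
  field_simp
  ring

/-- The defect is (abc/e)(T + U - V)²: it vanishes exactly when the three values are the outputs of
a single point of the plane. -/
theorem quadratic_jointTransport_le {a b c : ℝ} (ha : 0 < a) (hb : 0 < b) (hc : 0 < c)
    (T U V : ℝ → ℝ) (z : ℝ × ℝ) :
    a * (jointTransport a b c T U V z).1 ^ 2 + b * (jointTransport a b c T U V z).2 ^ 2 +
      c * ((jointTransport a b c T U V z).1 + (jointTransport a b c T U V z).2) ^ 2 ≤
      a * T z.1 ^ 2 + b * U z.2 ^ 2 + c * V (z.1 + z.2) ^ 2 := by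
  have hE : 0 < a * b + a * c + b * c := by positivity
  have h : 0 ≤ a * b * c / (a * b + a * c + b * c) * (T z.1 + U z.2 - V (z.1 + z.2)) ^ 2 := by
    positivity
  rw [← sub_nonneg]
  refine h.trans_eq ?_
  simp only [jointTransport]
  field_simp
  ring

end Transport

/-! ### The sharp Young inequality on the line and its degenerate cases -/

section Young

open ProbabilityTheory

/-- The optimal constant in Young's inequality with exponents `a (b + c) / e`, `b (a + c) / e` and
`c (a + b) / e`, where `e = a b + a c + b c`. -/
noncomputable def youngConst (a b c : ℝ) : ℝ :=
  Real.exp (-(Real.log (a * b + a * c + b * c) +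
    a * (b + c) / (a * b + a * c + b * c) * Real.log ((b + c) / (a * b + a * c + b * c)) +
    b * (a + c) / (a * b + a * c + b * c) * Real.log ((a + c) / (a * b + a * c + b * c)) +
    c * (a + b) / (a * b + a * c + b * c) * Real.log ((a + b) / (a * b + a * c + b * c))) / 2)

theorem inv_sqrt_rpow {x p : ℝ} (hx : 0 < x) :
    ((√(2 * Real.pi * x))⁻¹) ^ p =
      Real.exp (-(p * (Real.log (2 * Real.pi) + Real.log x)) / 2) := by
  have h2 : 0 < 2 * Real.pi * x := by positivity
  rw [Real.rpow_def_of_pos (by positivity), Real.log_inv, Real.log_sqrt h2.le,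
    Real.log_mul (by positivity) hx.ne']
  ring_nf

/-- The left side is the value of the Young integral when all three densities are the matching
Gaussians. The powers of 2π cancel because the exponents sum to 2. -/
theorem youngConst_eq {a b c : ℝ} (ha : 0 < a) (hb : 0 < b) (hc : 0 < c) :
    ((√(2 * Real.pi * ((b + c) / (a * b + a * c + b * c))))⁻¹) ^
        (a * (b + c) / (a * b + a * c + b * c)) *
      ((√(2 * Real.pi * ((a + c) / (a * b + a * c + b * c))))⁻¹) ^
        (b * (a + c) / (a * b + a * c + b * c)) *
      ((√(2 * Real.pi * ((a + b) / (a * b + a * c + b * c))))⁻¹) ^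
        (c * (a + b) / (a * b + a * c + b * c)) *
      (2 * Real.pi / √(a * b + a * c + b * c)) = youngConst a b c := by
  have hE : 0 < a * b + a * c + b * c := by positivity
  have h4 : 2 * Real.pi / √(a * b + a * c + b * c) =
      Real.exp (Real.log (2 * Real.pi) - Real.log (a * b + a * c + b * c) / 2) := by
    rw [Real.exp_sub, Real.exp_log (by positivity), ← Real.log_sqrt hE.le,
      Real.exp_log (by positivity)]
  have hp : a * (b + c) / (a * b + a * c + b * c) + b * (a + c) / (a * b + a * c + b * c) +
      c * (a + b) / (a * b + a * c + b * c) = 2 := by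
    field_simp
    ring
  rw [inv_sqrt_rpow (by positivity), inv_sqrt_rpow (by positivity), inv_sqrt_rpow (by positivity),
    h4, ← Real.exp_add, ← Real.exp_add, ← Real.exp_add, youngConst]
  congr 1
  linear_combination (-Real.log (2 * Real.pi) / 2) * hp

theorem lintegral_exp_neg_quadratic {a b c : ℝ} (ha : 0 < a) (hb : 0 < b) (hc : 0 < c) :
    ∫⁻ z : ℝ × ℝ, ENNReal.ofReal
        (Real.exp (-(a * z.1 ^ 2 + b * z.2 ^ 2 + c * (z.1 + z.2) ^ 2) / 2)) =
      ENNReal.ofReal (2 * Real.pi / √(a * b + a * c + b * c)) := by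
  have hE : 0 < a * b + a * c + b * c := by positivity
  -- Completing the square in y: under the Gaussian law with inverse covariance Σ⁻¹, x has variance
  -- `w`, and y given x has variance `v` and mean -cx/(b + c).
  set v : NNReal := Real.toNNReal (1 / (b + c)) with hv
  set w : NNReal := Real.toNNReal ((b + c) / (a * b + a * c + b * c)) with hw
  have hv1 : (v : ℝ) = 1 / (b + c) := Real.coe_toNNReal _ (by positivity)
  have hw1 : (w : ℝ) = (b + c) / (a * b + a * c + b * c) := Real.coe_toNNReal _ (by positivity)
  have hv0 : v ≠ 0 := by
    rw [← NNReal.coe_ne_zero, hv1]; positivity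
  have hw0 : w ≠ 0 := by
    rw [← NNReal.coe_ne_zero, hw1]; positivity
  have key : ∀ x y : ℝ, ENNReal.ofReal
      (Real.exp (-(a * x ^ 2 + b * y ^ 2 + c * (x + y) ^ 2) / 2)) =
      ENNReal.ofReal (2 * Real.pi / √(a * b + a * c + b * c)) *
        (gaussianPDF 0 w x * gaussianPDF (-(c * x / (b + c))) v y) := by
    intro x y
    rw [gaussianPDF, gaussianPDF, ← ENNReal.ofReal_mul (gaussianPDFReal_nonneg _ _ _),
      ← ENNReal.ofReal_mul (by positivity), gaussianPDFReal, gaussianPDFReal, hv1, hw1]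
    congr 1
    have h1 : √(2 * Real.pi * ((b + c) / (a * b + a * c + b * c))) *
        √(2 * Real.pi * (1 / (b + c))) = 2 * Real.pi / √(a * b + a * c + b * c) := by
      rw [← Real.sqrt_mul (by positivity)]
      have : 2 * Real.pi * ((b + c) / (a * b + a * c + b * c)) * (2 * Real.pi * (1 / (b + c))) =
          (2 * Real.pi) ^ 2 / (a * b + a * c + b * c) := by
        field_simp
      rw [this, Real.sqrt_div (by positivity), Real.sqrt_sq (by positivity)]
    have h2 : Real.exp (-(a * x ^ 2 + b * y ^ 2 + c * (x + y) ^ 2) / 2) =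
        Real.exp (-(x - 0) ^ 2 / (2 * ((b + c) / (a * b + a * c + b * c)))) *
        Real.exp (-(y - -(c * x / (b + c))) ^ 2 / (2 * (1 / (b + c)))) := by
      rw [← Real.exp_add]
      congr 1
      field_simp
      ring
    rw [h2, ← h1]
    field_simp
  rw [Measure.volume_eq_prod, lintegral_prod _ (by fun_prop)]
  simp_rw [key]
  have hin : ∀ x : ℝ, ∫⁻ y, ENNReal.ofReal (2 * Real.pi / √(a * b + a * c + b * c)) *
        (gaussianPDF 0 w x * gaussianPDF (-(c * x / (b + c))) v y) =
        ENNReal.ofReal (2 * Real.pi / √(a * b + a * c + b * c)) * gaussianPDF 0 w x := by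
    intro x
    rw [lintegral_const_mul _ (by fun_prop), lintegral_const_mul _ (by fun_prop),
      lintegral_gaussianPDF_eq_one _ hv0, mul_one]
  simp_rw [hin]
  rw [lintegral_const_mul _ (by fun_prop), lintegral_gaussianPDF_eq_one _ hw0, mul_one]

/-- The exponent a v cancels the variance v: the Gaussian density to this power is a constant times
exp(-a u²/2). The quotient that remains is the derivative of the transport map. -/
theorem rpow_eq_of_eq_div_gaussianPDFReal {a v f u : ℝ} (hv : 0 < v) (hf : 0 < f) :
    f ^ (a * v) = (f / gaussianPDFReal 0 (Real.toNNReal v) u) ^ (a * v) *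
      ((√(2 * Real.pi * v))⁻¹ ^ (a * v) * Real.exp (-(a * u ^ 2) / 2)) := by
  have hg := gaussianPDFReal_pos 0 (Real.toNNReal v) u (by simpa using hv)
  have h1 : (√(2 * Real.pi * v))⁻¹ ^ (a * v) * Real.exp (-(a * u ^ 2) / 2) =
      gaussianPDFReal 0 (Real.toNNReal v) u ^ (a * v) := by
    rw [gaussianPDFReal, Real.coe_toNNReal _ hv.le, Real.mul_rpow (by positivity) (by positivity),
      ← Real.exp_mul]
    congr 2
    field_simp
    ring
  rw [h1, ← Real.mul_rpow (by positivity) hg.le, div_mul_cancel₀ _ hg.ne']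

/-- Sharp Young inequality for continuous positive probability densities. -/
theorem lintegral_young_le_of_continuous {a b c : ℝ} (ha : 0 < a) (hb : 0 < b) (hc : 0 < c)
    {f g h : ℝ → ℝ} (hf : Continuous f) (hg : Continuous g) (hh : Continuous h)
    (hfi : Integrable f) (hgi : Integrable g) (hhi : Integrable h)
    (hf0 : ∀ x, 0 < f x) (hg0 : ∀ x, 0 < g x) (hh0 : ∀ x, 0 < h x)
    (hf1 : ∫ x, f x = 1) (hg1 : ∫ x, g x = 1) (hh1 : ∫ x, h x = 1) :
    ∫⁻ z : ℝ × ℝ, ENNReal.ofReal (f z.1 ^ (a * (b + c) / (a * b + a * c + b * c)) *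
      g z.2 ^ (b * (a + c) / (a * b + a * c + b * c)) *
      h (z.1 + z.2) ^ (c * (a + b) / (a * b + a * c + b * c))) ≤
      ENNReal.ofReal (youngConst a b c) := by
  have tr : ∀ {u : ℝ → ℝ} {v : ℝ}, Continuous u → Integrable u → (∀ x, 0 < u x) →
      ∫ x, u x = 1 → 0 < v → ∃ T : ℝ → ℝ, StrictMono T ∧
        ∀ x, HasDerivAt T (u x / gaussianPDFReal 0 (Real.toNNReal v) (T x)) x := by
    intro u v hu hui hu0 hu1 hv
    have hv' : Real.toNNReal v ≠ 0 := by simpa using hv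
    refine exists_transport hu ?_ hui (integrable_gaussianPDFReal _ _) hu0
      (fun x => gaussianPDFReal_pos _ _ _ hv') (by rw [hu1, integral_gaussianPDFReal_eq_one _ hv'])
    rw [gaussianPDFReal_def]
    fun_prop
  have hE : 0 < a * b + a * c + b * c := by positivity
  have hv1 : 0 < (b + c) / (a * b + a * c + b * c) := by positivity
  have hv2 : 0 < (a + c) / (a * b + a * c + b * c) := by positivity
  have hv3 : 0 < (a + b) / (a * b + a * c + b * c) := by positivity
  obtain ⟨T, hTm, hT⟩ := tr hf hfi hf0 hf1 hv1
  obtain ⟨U, hUm, hU⟩ := tr hg hgi hg0 hg1 hv2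
  obtain ⟨V, hVm, hV⟩ := tr hh hhi hh0 hh1 hv3
  set k := ((√(2 * Real.pi * ((b + c) / (a * b + a * c + b * c))))⁻¹) ^
        (a * (b + c) / (a * b + a * c + b * c)) *
      ((√(2 * Real.pi * ((a + c) / (a * b + a * c + b * c))))⁻¹) ^
        (b * (a + c) / (a * b + a * c + b * c)) *
      ((√(2 * Real.pi * ((a + b) / (a * b + a * c + b * c))))⁻¹) ^
        (c * (a + b) / (a * b + a * c + b * c)) with hk
  have hk0 : 0 ≤ k := by positivity
  set Q : ℝ × ℝ → ℝ≥0∞ := fun z => ENNReal.ofReal k * ENNReal.ofReal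
        (Real.exp (-(a * z.1 ^ 2 + b * z.2 ^ 2 + c * (z.1 + z.2) ^ 2) / 2)) with hQ
  have hQi : ∫⁻ z, Q z = ENNReal.ofReal (youngConst a b c) := by
    rw [hQ, lintegral_const_mul _ (by fun_prop), lintegral_exp_neg_quadratic ha hb hc,
      ← ENNReal.ofReal_mul hk0, youngConst_eq ha hb hc]
  have hcv := lintegral_image_eq_lintegral_abs_det_fderiv_mul (volume : Measure (ℝ × ℝ))
    MeasurableSet.univ
    (fun z _ => (hasFDerivAt_jointTransport (a := a) (b := b) (c := c) (hT z.1) (hU z.2)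
      (hV (z.1 + z.2))).hasFDerivWithinAt)
    (jointTransport_injective ha hb hc hTm hUm hVm).injOn Q
  rw [← hQi, ← setLIntegral_univ]
  -- The joint map need not be known to be onto: integrating over its image only decreases the
  -- Gaussian integral, which is the direction needed.
  refine le_trans ?_ (setLIntegral_le_lintegral (jointTransport a b c T U V '' univ) _)
  rw [hcv]
  refine lintegral_mono fun z => ?_
  rw [det_jointTransport ha hb hc, hQ]
  simp only
  have p1 := div_pos (hf0 z.1) (gaussianPDFReal_pos 0
    (Real.toNNReal ((b + c) / (a * b + a * c + b * c))) (T z.1) (by simpa using hv1))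
  have p2 := div_pos (hg0 z.2) (gaussianPDFReal_pos 0
    (Real.toNNReal ((a + c) / (a * b + a * c + b * c))) (U z.2) (by simpa using hv2))
  have p3 := div_pos (hh0 (z.1 + z.2)) (gaussianPDFReal_pos 0
    (Real.toNNReal ((a + b) / (a * b + a * c + b * c))) (V (z.1 + z.2)) (by simpa using hv3))
  have e1 := rpow_eq_of_eq_div_gaussianPDFReal (a := a) (u := T z.1) hv1 (hf0 z.1)
  have e2 := rpow_eq_of_eq_div_gaussianPDFReal (a := b) (u := U z.2) hv2 (hg0 z.2)
  have e3 := rpow_eq_of_eq_div_gaussianPDFReal (a := c) (u := V (z.1 + z.2)) hv3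
    (hh0 (z.1 + z.2))
  rw [← mul_div_assoc a (b + c)] at e1
  rw [← mul_div_assoc b (a + c)] at e2
  rw [← mul_div_assoc c (a + b)] at e3
  rw [e1, e2, e3]
  set t := f z.1 / gaussianPDFReal 0
    (Real.toNNReal ((b + c) / (a * b + a * c + b * c))) (T z.1)
  set u := g z.2 / gaussianPDFReal 0
    (Real.toNNReal ((a + c) / (a * b + a * c + b * c))) (U z.2)
  set v := h (z.1 + z.2) / gaussianPDFReal 0
    (Real.toNNReal ((a + b) / (a * b + a * c + b * c))) (V (z.1 + z.2))
  have hdet : 0 < (a * b * (t * u) + a * c * (t * v) + b * c * (u * v)) /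
      (a * b + a * c + b * c) := by positivity
  have hexp : Real.exp (-(a * T z.1 ^ 2) / 2) * Real.exp (-(b * U z.2 ^ 2) / 2) *
      Real.exp (-(c * V (z.1 + z.2) ^ 2) / 2) ≤
      Real.exp (-(a * (jointTransport a b c T U V z).1 ^ 2 +
        b * (jointTransport a b c T U V z).2 ^ 2 +
        c * ((jointTransport a b c T U V z).1 + (jointTransport a b c T U V z).2) ^ 2) / 2) := by
    rw [← Real.exp_add, ← Real.exp_add]
    apply Real.exp_le_exp.2
    have := quadratic_jointTransport_le ha hb hc T U V z
    linarith
  rw [← ENNReal.ofReal_mul hk0, ← ENNReal.ofReal_mul (abs_nonneg _), abs_of_pos hdet]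
  apply ENNReal.ofReal_le_ofReal
  have hamgm := rpow_mul_rpow_mul_rpow_le ha hb hc p1 p2 p3
  calc _ = (t ^ (a * (b + c) / (a * b + a * c + b * c)) *
          u ^ (b * (a + c) / (a * b + a * c + b * c)) *
          v ^ (c * (a + b) / (a * b + a * c + b * c))) * (k *
        (Real.exp (-(a * T z.1 ^ 2) / 2) * Real.exp (-(b * U z.2 ^ 2) / 2) *
          Real.exp (-(c * V (z.1 + z.2) ^ 2) / 2))) := by rw [hk]; ring
    _ ≤ _ := mul_le_mul hamgm (mul_le_mul_of_nonneg_left hexp hk0) (by positivity) hdet.le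

/-- Continuous functions with compact support are dense in L¹. The absolute value and a small
multiple of a Gaussian density make the approximants strictly positive, and a subsequence converges
almost everywhere. -/
theorem exists_continuous_pos_tendsto {f : ℝ → ℝ≥0∞} (hf : Measurable f)
    (hfi : ∫⁻ x, f x ≠ ⊤) :
    ∃ φ : ℕ → ℝ → ℝ, (∀ k, Continuous (φ k)) ∧ (∀ k, Integrable (φ k)) ∧ (∀ k x, 0 < φ k x) ∧
      (∀ᵐ x, Tendsto (fun k => ENNReal.ofReal (φ k x)) atTop (𝓝 (f x))) ∧
      Tendsto (fun k => ∫⁻ x, ENNReal.ofReal (φ k x)) atTop (𝓝 (∫⁻ x, f x)) := by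
  have hF : Integrable (fun x => (f x).toReal) :=
    integrable_toReal_of_lintegral_ne_top hf.aemeasurable hfi
  have hfF : (fun x => ENNReal.ofReal (f x).toReal) =ᵐ[volume] f := by
    filter_upwards [ae_lt_top hf hfi] with x hx using ENNReal.ofReal_toReal hx.ne
  have hcont : Continuous (gaussianPDFReal 0 1) := by
    rw [gaussianPDFReal_def]; fun_prop
  set ε : ℕ → ℝ := fun k => 1 / ((k : ℝ) + 1) with hε
  have hε0 : ∀ k, 0 < ε k := fun k => by positivity
  have hεt : Tendsto (fun k => ENNReal.ofReal (ε k)) atTop (𝓝 0) := by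
    have := ENNReal.tendsto_ofReal (tendsto_one_div_add_atTop_nhds_zero_nat (𝕜 := ℝ))
    rwa [ENNReal.ofReal_zero] at this
  have hex := fun k => hF.exists_hasCompactSupport_lintegral_sub_le (ε := ENNReal.ofReal (ε k))
    (by simpa using hε0 k)
  choose g _ hg2 hg3 hg4 using hex
  set ψ : ℕ → ℝ → ℝ := fun k x => |g k x| + ε k * gaussianPDFReal 0 1 x with hψ
  have hψi : ∀ k, Integrable (ψ k) := fun k =>
    (hg4 k).abs.add ((integrable_gaussianPDFReal 0 1).const_mul _)
  have hL1 : ∀ k, eLpNorm (ψ k - fun x => (f x).toReal) 1 volume ≤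
      ENNReal.ofReal (ε k) + ENNReal.ofReal (ε k) := by
    intro k
    rw [eLpNorm_one_eq_lintegral_enorm]
    calc ∫⁻ x, ‖(ψ k - fun x => (f x).toReal) x‖ₑ
        ≤ ∫⁻ x, (‖(f x).toReal - g k x‖ₑ + ENNReal.ofReal (ε k) * gaussianPDF 0 1 x) := by
          refine lintegral_mono fun x => ?_
          simp only [hψ, Pi.sub_apply, gaussianPDF]
          rw [← ENNReal.ofReal_mul (hε0 k).le, Real.enorm_eq_ofReal_abs, Real.enorm_eq_ofReal_abs,
            ← ENNReal.ofReal_add (abs_nonneg _)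
              (mul_nonneg (hε0 k).le (gaussianPDFReal_nonneg _ _ _))]
          apply ENNReal.ofReal_le_ofReal
          have h1 : 0 ≤ ε k * gaussianPDFReal 0 1 x :=
            mul_nonneg (hε0 k).le (gaussianPDFReal_nonneg _ _ _)
          have h2 := abs_abs_sub_abs_le_abs_sub (g k x) (f x).toReal
          rw [abs_of_nonneg (ENNReal.toReal_nonneg (a := f x)), abs_sub_comm (g k x)] at h2
          calc _ = |(|g k x| - (f x).toReal) + ε k * gaussianPDFReal 0 1 x| := by ring_nf
            _ ≤ |(|g k x| - (f x).toReal)| + |ε k * gaussianPDFReal 0 1 x| := abs_add_le _ _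
            _ ≤ _ := by rw [abs_of_nonneg h1]; gcongr
      _ = (∫⁻ x, ‖(f x).toReal - g k x‖ₑ) + ENNReal.ofReal (ε k) := by
          rw [lintegral_add_right _ (by fun_prop), lintegral_const_mul _ (by fun_prop),
            lintegral_gaussianPDF_eq_one _ one_ne_zero, mul_one]
      _ ≤ _ := by gcongr; exact hg2 k
  have hlim : Tendsto (fun k => eLpNorm (ψ k - fun x => (f x).toReal) 1 volume) atTop (𝓝 0) := by
    refine tendsto_of_tendsto_of_tendsto_of_le_of_le tendsto_const_nhds ?_ (fun _ => zero_le) hL1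
    simpa using hεt.add hεt
  obtain ⟨ns, hns, hae⟩ := (tendstoInMeasure_of_tendsto_eLpNorm one_ne_zero
    (fun k => (hψi k).aestronglyMeasurable) hF.aestronglyMeasurable hlim).exists_seq_tendsto_ae
  have hpos : ∀ k x, 0 < ψ k x := fun k x =>
    add_pos_of_nonneg_of_pos (abs_nonneg _)
      (mul_pos (hε0 k) (gaussianPDFReal_pos 0 1 x one_ne_zero))
  refine ⟨fun k => ψ (ns k), fun k => ?_, fun k => hψi _, fun k => hpos _, ?_, ?_⟩
  · exact (hg3 _).abs.add (continuous_const.mul hcont)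
  · filter_upwards [hae, hfF] with x hx hfx
    rw [← hfx]
    exact ENNReal.tendsto_ofReal hx
  · have h1 := tendsto_integral_of_L1' _ hF.aestronglyMeasurable
      (Eventually.of_forall hψi) hlim
    have h2 := (ENNReal.tendsto_ofReal h1).comp hns.tendsto_atTop
    have h3 : ENNReal.ofReal (∫ x, (f x).toReal) = ∫⁻ x, f x := by
      rw [ofReal_integral_eq_lintegral_ofReal hF
        (Eventually.of_forall fun _ => ENNReal.toReal_nonneg), lintegral_congr_ae hfF]
    rw [h3] at h2
    refine h2.congr fun k => ?_
    rw [Function.comp, ofReal_integral_eq_lintegral_ofReal (hψi _)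
      (Eventually.of_forall fun x => (hpos _ x).le)]

/-- Young's inequality on `G`, in its symmetric form, with exponents `p`, `q`, `r` and
constant `C`. -/
def HasYoungBound (G : Type*) [Add G] [MeasureSpace G] (p q r : ℝ) (C : ℝ≥0∞) : Prop :=
  ∀ f g h : G → ℝ≥0∞, Measurable f → Measurable g → Measurable h →
    ∫⁻ x, ∫⁻ y, f x ^ p * g y ^ q * h (x + y) ^ r ≤
      C * ((∫⁻ x, f x) ^ p * (∫⁻ x, g x) ^ q * (∫⁻ x, h x) ^ r)

/-- Both sides scale in the same way in each function, so dividing by the masses reduces to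
probability densities. -/
theorem lintegral_young_le_of_continuous' {a b c : ℝ} (ha : 0 < a) (hb : 0 < b) (hc : 0 < c)
    {f g h : ℝ → ℝ} (hf : Continuous f) (hg : Continuous g) (hh : Continuous h)
    (hfi : Integrable f) (hgi : Integrable g) (hhi : Integrable h)
    (hf0 : ∀ x, 0 < f x) (hg0 : ∀ x, 0 < g x) (hh0 : ∀ x, 0 < h x) :
    ∫⁻ z : ℝ × ℝ, (ENNReal.ofReal (f z.1) ^ (a * (b + c) / (a * b + a * c + b * c)) *
      ENNReal.ofReal (g z.2) ^ (b * (a + c) / (a * b + a * c + b * c)) *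
      ENNReal.ofReal (h (z.1 + z.2)) ^ (c * (a + b) / (a * b + a * c + b * c))) ≤
      ENNReal.ofReal (youngConst a b c) *
        ((∫⁻ x, ENNReal.ofReal (f x)) ^ (a * (b + c) / (a * b + a * c + b * c)) *
         (∫⁻ x, ENNReal.ofReal (g x)) ^ (b * (a + c) / (a * b + a * c + b * c)) *
         (∫⁻ x, ENNReal.ofReal (h x)) ^ (c * (a + b) / (a * b + a * c + b * c))) := by
  have hI : ∀ {u : ℝ → ℝ}, Continuous u → Integrable u → (∀ x, 0 < u x) → 0 < ∫ x, u x := by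
    intro u hu hui hu0
    rw [integral_pos_iff_support_of_nonneg (fun x => (hu0 x).le) hui]
    have : Function.support u = univ := by
      ext x; simp [(hu0 x).ne']
    simp [this]
  have hA := hI hf hfi hf0
  have hB := hI hg hgi hg0
  have hC := hI hh hhi hh0
  rw [← ofReal_integral_eq_lintegral_ofReal hfi (Eventually.of_forall fun x => (hf0 x).le),
    ← ofReal_integral_eq_lintegral_ofReal hgi (Eventually.of_forall fun x => (hg0 x).le),
    ← ofReal_integral_eq_lintegral_ofReal hhi (Eventually.of_forall fun x => (hh0 x).le)]
  set A := ∫ x, f x with hAd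
  set B := ∫ x, g x with hBd
  set C := ∫ x, h x with hCd
  have hmain := lintegral_young_le_of_continuous ha hb hc (hf.div_const A) (hg.div_const B)
    (hh.div_const C) (hfi.div_const A) (hgi.div_const B) (hhi.div_const C)
    (fun x => div_pos (hf0 x) hA) (fun x => div_pos (hg0 x) hB) (fun x => div_pos (hh0 x) hC)
    (by rw [integral_div, div_self hA.ne']) (by rw [integral_div, div_self hB.ne'])
    (by rw [integral_div, div_self hC.ne'])
  set p := a * (b + c) / (a * b + a * c + b * c)
  set q := b * (a + c) / (a * b + a * c + b * c)
  set r := c * (a + b) / (a * b + a * c + b * c)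
  have key : ∀ z : ℝ × ℝ, ENNReal.ofReal (f z.1) ^ p * ENNReal.ofReal (g z.2) ^ q *
      ENNReal.ofReal (h (z.1 + z.2)) ^ r =
      ENNReal.ofReal (A ^ p * B ^ q * C ^ r) *
      ENNReal.ofReal ((f z.1 / A) ^ p * (g z.2 / B) ^ q * (h (z.1 + z.2) / C) ^ r) := by
    intro z
    rw [ENNReal.ofReal_rpow_of_pos (hf0 _), ENNReal.ofReal_rpow_of_pos (hg0 _),
      ENNReal.ofReal_rpow_of_pos (hh0 _),
      ← ENNReal.ofReal_mul (Real.rpow_nonneg (hf0 _).le _),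
      ← ENNReal.ofReal_mul (mul_nonneg (Real.rpow_nonneg (hf0 _).le _)
        (Real.rpow_nonneg (hg0 _).le _)), ← ENNReal.ofReal_mul (by positivity),
      Real.div_rpow (hf0 _).le hA.le, Real.div_rpow (hg0 _).le hB.le,
      Real.div_rpow (hh0 _).le hC.le]
    congr 1
    have := (Real.rpow_pos_of_pos hA p).ne'
    have := (Real.rpow_pos_of_pos hB q).ne'
    have := (Real.rpow_pos_of_pos hC r).ne'
    field_simp
  simp_rw [key]
  rw [lintegral_const_mul' _ _ ENNReal.ofReal_ne_top, mul_comm (ENNReal.ofReal (youngConst a b c)),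
    ENNReal.ofReal_rpow_of_pos hA, ENNReal.ofReal_rpow_of_pos hB, ENNReal.ofReal_rpow_of_pos hC,
    ← ENNReal.ofReal_mul (by positivity), ← ENNReal.ofReal_mul (by positivity)]
  gcongr

/-- The sharp Young inequality on the line. -/
theorem hasYoungBound_real {a b c : ℝ} (ha : 0 < a) (hb : 0 < b) (hc : 0 < c) :
    HasYoungBound ℝ (a * (b + c) / (a * b + a * c + b * c)) (b * (a + c) / (a * b + a * c + b * c))
      (c * (a + b) / (a * b + a * c + b * c)) (ENNReal.ofReal (youngConst a b c)) := by
  intro f g h hf hg hh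
  have hlim := fun {f g h : ℝ → ℝ} => lintegral_young_le_of_continuous' ha hb hc
    (f := f) (g := g) (h := h)
  have hp : 0 < a * (b + c) / (a * b + a * c + b * c) := by positivity
  have hq : 0 < b * (a + c) / (a * b + a * c + b * c) := by positivity
  have hr : 0 < c * (a + b) / (a * b + a * c + b * c) := by positivity
  have hK : 0 < youngConst a b c := Real.exp_pos _
  set p := a * (b + c) / (a * b + a * c + b * c)
  set q := b * (a + c) / (a * b + a * c + b * c)
  set r := c * (a + b) / (a * b + a * c + b * c)
  -- Zero masses are treated first; once they are excluded, an infinite mass makes the right side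
  -- infinite rather than 0 · ∞.
  by_cases hf0 : ∫⁻ x, f x = 0
  · refine le_of_eq_of_le ?_ zero_le
    rw [lintegral_eq_zero_iff hf] at hf0
    refine lintegral_eq_zero_of_ae_eq_zero ?_
    filter_upwards [hf0] with x hx
    simp [hx, hp]
  by_cases hg0 : ∫⁻ x, g x = 0
  · refine le_of_eq_of_le ?_ zero_le
    rw [lintegral_eq_zero_iff hg] at hg0
    refine lintegral_eq_zero_of_ae_eq_zero (Eventually.of_forall fun x => ?_)
    refine lintegral_eq_zero_of_ae_eq_zero ?_
    filter_upwards [hg0] with y hy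
    simp [hy, hq]
  by_cases hh0 : ∫⁻ x, h x = 0
  · refine le_of_eq_of_le ?_ zero_le
    rw [lintegral_eq_zero_iff hh] at hh0
    refine lintegral_eq_zero_of_ae_eq_zero (Eventually.of_forall fun x => ?_)
    refine lintegral_eq_zero_of_ae_eq_zero ?_
    filter_upwards [(measurePreserving_add_left volume x).quasiMeasurePreserving.ae hh0] with y hy
    simp only [Pi.zero_apply] at hy
    simp [hy, hr]
  have hne : ∀ {x : ℝ≥0∞} {s : ℝ}, 0 < s → x ≠ 0 → x ^ s ≠ 0 := by
    intro x s hs hx h0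
    rcases ENNReal.rpow_eq_zero_iff.1 h0 with h1 | h1
    · exact hx h1.1
    · linarith [h1.2]
  have hK0 : ENNReal.ofReal (youngConst a b c) ≠ 0 := by simpa using hK
  by_cases hft : ∫⁻ x, f x = ⊤
  · rw [hft, ENNReal.top_rpow_of_pos hp, ENNReal.top_mul (hne hq hg0),
      ENNReal.top_mul (hne hr hh0), ENNReal.mul_top hK0]
    exact le_top
  by_cases hgt : ∫⁻ x, g x = ⊤
  · rw [hgt, ENNReal.top_rpow_of_pos hq, ENNReal.mul_top (hne hp hf0),
      ENNReal.top_mul (hne hr hh0), ENNReal.mul_top hK0]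
    exact le_top
  by_cases hht : ∫⁻ x, h x = ⊤
  · rw [hht, ENNReal.top_rpow_of_pos hr, ENNReal.mul_top (mul_ne_zero (hne hp hf0) (hne hq hg0)),
      ENNReal.mul_top hK0]
    exact le_top
  obtain ⟨φ, hφc, hφi, hφ0, hφt, hφl⟩ := exists_continuous_pos_tendsto hf hft
  obtain ⟨χ, hχc, hχi, hχ0, hχt, hχl⟩ := exists_continuous_pos_tendsto hg hgt
  obtain ⟨ψ, hψc, hψi, hψ0, hψt, hψl⟩ := exists_continuous_pos_tendsto hh hht
  have htop : ∀ {x : ℝ≥0∞} {s : ℝ}, 0 < s → x ≠ ⊤ → x ^ s ≠ ⊤ :=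
    fun hs hx => ENNReal.rpow_ne_top_of_nonneg hs.le hx
  have hmul : ∀ {u v w : ℕ → ℝ≥0∞} {x y z : ℝ≥0∞}, x ≠ ⊤ → y ≠ ⊤ → z ≠ ⊤ →
      Tendsto u atTop (𝓝 x) → Tendsto v atTop (𝓝 y) → Tendsto w atTop (𝓝 z) →
      Tendsto (fun k => u k ^ p * v k ^ q * w k ^ r) atTop (𝓝 (x ^ p * y ^ q * z ^ r)) := by
    intro u v w x y z hx hy hz hu hv hw
    refine ENNReal.Tendsto.mul (ENNReal.Tendsto.mul (hu.ennrpow_const p) (Or.inr (htop hq hy))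
      (hv.ennrpow_const q) (Or.inr (htop hp hx))) (Or.inr (htop hr hz)) (hw.ennrpow_const r)
      (Or.inr (ENNReal.mul_ne_top (htop hp hx) (htop hq hy)))
  have hq1 := Measure.quasiMeasurePreserving_fst (μ := (volume : Measure ℝ))
    (ν := (volume : Measure ℝ))
  have hq2 := Measure.quasiMeasurePreserving_snd (μ := (volume : Measure ℝ))
    (ν := (volume : Measure ℝ))
  have hq3 := hq2.comp (measurePreserving_prod_add (volume : Measure ℝ)
    (volume : Measure ℝ)).quasiMeasurePreserving
  have hfin := ((ae_lt_top hf hft).and hφt)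
  have hgin := ((ae_lt_top hg hgt).and hχt)
  have hhin := ((ae_lt_top hh hht).and hψt)
  have hae : ∀ᵐ z ∂((volume : Measure ℝ).prod volume), f z.1 ^ p * g z.2 ^ q * h (z.1 + z.2) ^ r ≤
      liminf (fun k => ENNReal.ofReal (φ k z.1) ^ p * ENNReal.ofReal (χ k z.2) ^ q *
        ENNReal.ofReal (ψ k (z.1 + z.2)) ^ r) atTop := by
    filter_upwards [hq1.ae hfin, hq2.ae hgin, hq3.ae hhin] with z h1 h2 h3
    exact (hmul h1.1.ne h2.1.ne h3.1.ne h1.2 h2.2 h3.2).liminf_eq.ge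
  have hmf : Measurable (fun z : ℝ × ℝ => f z.1 ^ p * g z.2 ^ q * h (z.1 + z.2) ^ r) := by
    fun_prop
  have hR : Tendsto (fun k => ENNReal.ofReal (youngConst a b c) *
        ((∫⁻ x, ENNReal.ofReal (φ k x)) ^ p * (∫⁻ x, ENNReal.ofReal (χ k x)) ^ q *
         (∫⁻ x, ENNReal.ofReal (ψ k x)) ^ r)) atTop (𝓝 (ENNReal.ofReal (youngConst a b c) *
          ((∫⁻ x, f x) ^ p * (∫⁻ x, g x) ^ q * (∫⁻ x, h x) ^ r))) :=
    ENNReal.Tendsto.const_mul (hmul hft hgt hht hφl hχl hψl) (Or.inr ENNReal.ofReal_ne_top)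
  -- Fatou's lemma passes from the continuous positive approximants to the limit, and their masses
  -- converge on the right.
  calc ∫⁻ x, ∫⁻ y, f x ^ p * g y ^ q * h (x + y) ^ r
      = ∫⁻ z, f z.1 ^ p * g z.2 ^ q * h (z.1 + z.2) ^ r ∂((volume : Measure ℝ).prod volume) :=
        (lintegral_prod _ hmf.aemeasurable).symm
    _ ≤ ∫⁻ z, liminf (fun k => ENNReal.ofReal (φ k z.1) ^ p * ENNReal.ofReal (χ k z.2) ^ q *
        ENNReal.ofReal (ψ k (z.1 + z.2)) ^ r) atTop ∂((volume : Measure ℝ).prod volume) :=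
        lintegral_mono_ae hae
    _ ≤ liminf (fun k => ∫⁻ z, ENNReal.ofReal (φ k z.1) ^ p * ENNReal.ofReal (χ k z.2) ^ q *
        ENNReal.ofReal (ψ k (z.1 + z.2)) ^ r ∂((volume : Measure ℝ).prod volume)) atTop := by
        refine lintegral_liminf_le fun k => ?_
        have := (hφc k).measurable
        have := (hχc k).measurable
        have := (hψc k).measurable
        fun_prop
    _ ≤ liminf (fun k => ENNReal.ofReal (youngConst a b c) *
        ((∫⁻ x, ENNReal.ofReal (φ k x)) ^ p * (∫⁻ x, ENNReal.ofReal (χ k x)) ^ q *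
         (∫⁻ x, ENNReal.ofReal (ψ k x)) ^ r)) atTop := by
        refine liminf_le_liminf (Eventually.of_forall fun k => ?_)
        exact hlim (hφc k) (hχc k) (hψc k) (hφi k) (hχi k) (hψi k) (hφ0 k) (hχ0 k) (hψ0 k)
    _ = _ := hR.liminf_eq

/-- This and the next two bounds are the vertices of the exponent range: one function drops out, and
the double integral splits, after a translation if `h` remains. -/
theorem hasYoungBound_one_one_zero (G : Type*) [AddCommGroup G] [MeasureSpace G] :
    HasYoungBound G 1 1 0 1 := by
  intro f g h hf hg hh
  simp only [ENNReal.rpow_one, ENNReal.rpow_zero, mul_one, one_mul]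
  simp_rw [lintegral_const_mul _ hg]
  rw [lintegral_mul_const _ hf]

theorem hasYoungBound_one_zero_one (G : Type*) [AddCommGroup G] [MeasureSpace G]
    [MeasurableAdd₂ G] [(volume : Measure G).IsAddLeftInvariant] :
    HasYoungBound G 1 0 1 1 := by
  intro f g h hf hg hh
  simp only [ENNReal.rpow_one, ENNReal.rpow_zero, mul_one, one_mul]
  have : ∀ x, ∫⁻ y, f x * h (x + y) = f x * ∫⁻ y, h y := by
    intro x
    rw [lintegral_const_mul _ (by fun_prop), lintegral_add_left_eq_self h]
  simp_rw [this]
  rw [lintegral_mul_const _ hf]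

theorem hasYoungBound_zero_one_one (G : Type*) [AddCommGroup G] [MeasureSpace G]
    [MeasurableAdd₂ G] [SFinite (volume : Measure G)]
    [(volume : Measure G).IsAddLeftInvariant] :
    HasYoungBound G 0 1 1 1 := by
  intro f g h hf hg hh
  simp only [ENNReal.rpow_one, ENNReal.rpow_zero, one_mul]
  rw [lintegral_lintegral_swap (by fun_prop)]
  have : ∀ y, ∫⁻ x, g y * h (x + y) = g y * ∫⁻ y, h y := by
    intro y
    simp_rw [add_comm _ y]
    rw [lintegral_const_mul _ (by fun_prop), lintegral_add_left_eq_self h]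
  simp_rw [this]
  rw [lintegral_mul_const _ hg]

end Young

/-! ### Tensorisation to ℝⁿ and translation to the datum -/

section Tensor

theorem measurable_fin_cons {n : ℕ} :
    Measurable (fun z : ℝ × (Fin n → ℝ) => (Fin.cons z.1 z.2 : Fin (n + 1) → ℝ)) := by
  refine measurable_pi_iff.2 fun i => ?_
  refine Fin.cases ?_ (fun j => ?_) i
  · simpa using measurable_fst
  · simp only [Fin.cons_succ]
    fun_prop

theorem lintegral_pi_fin_succ {n : ℕ} {f : (Fin (n + 1) → ℝ) → ℝ≥0∞} (hf : Measurable f) :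
    ∫⁻ x, f x = ∫⁻ t : ℝ, ∫⁻ x : Fin n → ℝ, f (Fin.cons t x) := by
  have h := (volume_preserving_piFinSuccAbove (fun _ : Fin (n + 1) => ℝ) 0).symm
  have h1 : ∀ z : ℝ × (Fin n → ℝ),
      (MeasurableEquiv.piFinSuccAbove (fun _ : Fin (n + 1) => ℝ) 0).symm z =
        Fin.cons z.1 z.2 := by
    intro z
    simp [MeasurableEquiv.piFinSuccAbove, Fin.insertNthEquiv]
  rw [← h.lintegral_comp hf]
  simp_rw [h1]
  exact lintegral_prod _ (hf.comp measurable_fin_cons).aemeasurable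

/-- Induction on the dimension: for fixed first coordinates t, u the bound on ℝⁿ applies to the
slices, and the bound on ℝ then applies to the slice integrals. Each step costs a factor `C`. -/
theorem HasYoungBound.pi_fin {p q r : ℝ} {C : ℝ≥0∞}
    (hC : C ≠ ⊤) (H : HasYoungBound ℝ p q r C) (n : ℕ) :
    HasYoungBound (Fin n → ℝ) p q r (C ^ n) := by
  induction n with
  | zero =>
    intro f g h hf hg hh
    -- On ℝ⁰ every integral is evaluation at the point, so both sides are the same product.
    have hv : (volume : Measure (Fin 0 → ℝ)) = Measure.dirac 0 := Measure.pi_of_empty _ _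
    simp only [hv, lintegral_dirac, add_zero, pow_zero, one_mul, le_refl]
  | succ n ih =>
    intro f g h hf hg hh
    have hcons := measurable_fin_cons (n := n)
    have hF : ∀ {u : (Fin (n + 1) → ℝ) → ℝ≥0∞}, Measurable u →
        Measurable (fun t : ℝ => ∫⁻ x : Fin n → ℝ, u (Fin.cons t x)) := fun hu =>
      (hu.comp hcons).lintegral_prod_right'
    have hadd : ∀ (t u : ℝ) (x y : Fin n → ℝ), (Fin.cons t x : Fin (n + 1) → ℝ) + Fin.cons u y =
        Fin.cons (t + u) (x + y) := by
      intro t u x y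
      ext i
      refine Fin.cases ?_ (fun j => ?_) i <;> simp
    have hm : Measurable (fun z : (Fin (n + 1) → ℝ) × (Fin (n + 1) → ℝ) =>
        f z.1 ^ p * g z.2 ^ q * h (z.1 + z.2) ^ r) := by fun_prop
    have hswap : ∀ t : ℝ,
        ∫⁻ x : Fin n → ℝ, ∫⁻ u : ℝ, ∫⁻ y : Fin n → ℝ, f (Fin.cons t x) ^ p *
          g (Fin.cons u y) ^ q * h (Fin.cons t x + Fin.cons u y) ^ r =
        ∫⁻ u : ℝ, ∫⁻ x : Fin n → ℝ, ∫⁻ y : Fin n → ℝ, f (Fin.cons t x) ^ p *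
          g (Fin.cons u y) ^ q * h (Fin.cons (t + u) (x + y)) ^ r := by
      intro t
      simp_rw [← hadd]
      refine lintegral_lintegral_swap (Measurable.aemeasurable ?_)
      have h1 : Measurable (fun w : ((Fin n → ℝ) × ℝ) × (Fin n → ℝ) =>
          ((Fin.cons t w.1.1 : Fin (n + 1) → ℝ), (Fin.cons w.1.2 w.2 : Fin (n + 1) → ℝ))) :=
        Measurable.prodMk
          (hcons.comp (measurable_const.prodMk measurable_fst.fst))
          (hcons.comp (measurable_fst.snd.prodMk measurable_snd))
      exact (hm.comp h1).lintegral_prod_right'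
    have hin : ∀ t u : ℝ, ∫⁻ x : Fin n → ℝ, ∫⁻ y : Fin n → ℝ, f (Fin.cons t x) ^ p *
          g (Fin.cons u y) ^ q * h (Fin.cons (t + u) (x + y)) ^ r ≤
        C ^ n * ((∫⁻ x : Fin n → ℝ, f (Fin.cons t x)) ^ p *
          (∫⁻ x : Fin n → ℝ, g (Fin.cons u x)) ^ q *
          (∫⁻ x : Fin n → ℝ, h (Fin.cons (t + u) x)) ^ r) := by
      intro t u
      exact ih _ _ _ (hf.comp (hcons.comp measurable_prodMk_left))
        (hg.comp (hcons.comp measurable_prodMk_left))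
        (hh.comp (hcons.comp measurable_prodMk_left))
    calc ∫⁻ x, ∫⁻ y, f x ^ p * g y ^ q * h (x + y) ^ r
        = ∫⁻ t : ℝ, ∫⁻ x : Fin n → ℝ, ∫⁻ u : ℝ, ∫⁻ y : Fin n → ℝ, f (Fin.cons t x) ^ p *
          g (Fin.cons u y) ^ q * h (Fin.cons t x + Fin.cons u y) ^ r := by
          rw [lintegral_pi_fin_succ hm.lintegral_prod_right']
          refine lintegral_congr fun t => lintegral_congr fun x => ?_
          exact lintegral_pi_fin_succ (hm.comp measurable_prodMk_left)
      _ = ∫⁻ t : ℝ, ∫⁻ u : ℝ, ∫⁻ x : Fin n → ℝ, ∫⁻ y : Fin n → ℝ, f (Fin.cons t x) ^ p *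
          g (Fin.cons u y) ^ q * h (Fin.cons (t + u) (x + y)) ^ r := by simp_rw [hswap]
      _ ≤ ∫⁻ t : ℝ, ∫⁻ u : ℝ, C ^ n * ((∫⁻ x : Fin n → ℝ, f (Fin.cons t x)) ^ p *
          (∫⁻ x : Fin n → ℝ, g (Fin.cons u x)) ^ q *
          (∫⁻ x : Fin n → ℝ, h (Fin.cons (t + u) x)) ^ r) :=
          lintegral_mono fun t => lintegral_mono fun u => hin t u
      _ = C ^ n * ∫⁻ t : ℝ, ∫⁻ u : ℝ, ((∫⁻ x : Fin n → ℝ, f (Fin.cons t x)) ^ p *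
          (∫⁻ x : Fin n → ℝ, g (Fin.cons u x)) ^ q *
          (∫⁻ x : Fin n → ℝ, h (Fin.cons (t + u) x)) ^ r) := by
          have hn : C ^ n ≠ ⊤ := ENNReal.pow_ne_top hC
          simp_rw [lintegral_const_mul' _ _ hn]
      _ ≤ C ^ n * (C * ((∫⁻ x, f x) ^ p * (∫⁻ x, g x) ^ q * (∫⁻ x, h x) ^ r)) := by
          rw [lintegral_pi_fin_succ hf, lintegral_pi_fin_succ hg, lintegral_pi_fin_succ hh]
          gcongr
          exact H _ _ _ (hF hf) (hF hg) (hF hh)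
      _ = _ := by rw [pow_succ, mul_assoc (C ^ n)]

theorem lintegral_prod_datumZero_le {p : Fin 3 → ℝ} {n : ℕ} {C : ℝ≥0∞}
    (H : HasYoungBound (Fin n → ℝ) (p 0) (p 1) (p 2) C)
    (f : Fin 3 → (Fin n → ℝ) → ℝ≥0∞) (hf : ∀ i, Measurable (f i)) :
    ∫⁻ x : Fin n ⊕ Fin n → ℝ, ∏ i, f i (((datumZero n).B i).mulVec x) ^ p i ≤
      C * ∏ i, (∫⁻ x, f i x) ^ p i := by
  have h := (volume_measurePreserving_sumPiEquivProdPi (fun _ : Fin n ⊕ Fin n => ℝ)).symm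
  have h0 : ∀ z : (Fin n → ℝ) × (Fin n → ℝ), ((datumZero n).B 0).mulVec
      ((MeasurableEquiv.sumPiEquivProdPi (fun _ : Fin n ⊕ Fin n => ℝ)).symm z) = z.1 := by
    intro z; ext i
    simp [datumZero, Matrix.fromCols_mulVec, Function.comp_def,
      MeasurableEquiv.coe_sumPiEquivProdPi_symm]
  have h1 : ∀ z : (Fin n → ℝ) × (Fin n → ℝ), ((datumZero n).B 1).mulVec
      ((MeasurableEquiv.sumPiEquivProdPi (fun _ : Fin n ⊕ Fin n => ℝ)).symm z) = z.2 := by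
    intro z; ext i
    simp [datumZero, Matrix.fromCols_mulVec, Function.comp_def,
      MeasurableEquiv.coe_sumPiEquivProdPi_symm]
  have h2 : ∀ z : (Fin n → ℝ) × (Fin n → ℝ), ((datumZero n).B 2).mulVec
      ((MeasurableEquiv.sumPiEquivProdPi (fun _ : Fin n ⊕ Fin n => ℝ)).symm z) = z.1 + z.2 := by
    intro z; ext i
    simp [datumZero, Matrix.fromCols_mulVec, Function.comp_def,
      MeasurableEquiv.coe_sumPiEquivProdPi_symm]
  have hf0 := hf 0
  have hf1 := hf 1
  have hf2 := hf 2
  rw [← h.lintegral_comp_emb (MeasurableEquiv.measurableEmbedding _)]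
  simp only [Fin.prod_univ_three, h0, h1, h2]
  rw [Measure.volume_eq_prod, lintegral_prod _ (by fun_prop)]
  exact H _ _ _ hf0 hf1 hf2

end Tensor

/-! ### Entropy as an integral, and from functional inequalities to entropy inequalities -/

section Entropy

variable {ι : Type} [Fintype ι]

theorem measurable_logDensity (μ : Measure (ι → ℝ)) : Measurable (logDensity μ) :=
  Real.measurable_log.comp (Measure.measurable_rnDeriv _ _).ennreal_toReal

theorem refMeasure_const_pos (ι : Type) [Fintype ι] :
    0 < (2 * Real.pi) ^ (-(Fintype.card ι : ℝ) / 2) := by positivity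

instance sigmaFinite_refMeasure (ι : Type) [Fintype ι] : SigmaFinite (refMeasure ι) := by
  exact SMul.sigmaFinite (Real.toNNReal ((2 * Real.pi) ^ (-(Fintype.card ι : ℝ) / 2)))

theorem absolutelyContinuous_refMeasure : (volume : Measure (ι → ℝ)) ≪ refMeasure ι :=
  Measure.absolutelyContinuous_smul (by simpa using refMeasure_const_pos ι)

theorem lintegral_refMeasure (f : (ι → ℝ) → ℝ≥0∞) :
    ∫⁻ x, f x ∂(refMeasure ι) =
      ENNReal.ofReal ((2 * Real.pi) ^ (-(Fintype.card ι : ℝ) / 2)) * ∫⁻ x, f x := by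
  rw [refMeasure, lintegral_smul_measure, smul_eq_mul]

theorem integrable_of_lintegral_ofReal_ne_top {α : Type*} {mα : MeasurableSpace α} {μ : Measure α}
    {f : α → ℝ} (hf : AEStronglyMeasurable f μ) (h1 : ∫⁻ x, ENNReal.ofReal (f x) ∂μ ≠ ⊤)
    (h2 : ∫⁻ x, ENNReal.ofReal (-f x) ∂μ ≠ ⊤) : Integrable f μ := by
  refine ⟨hf, ?_⟩
  rw [HasFiniteIntegral]
  calc ∫⁻ x, ‖f x‖ₑ ∂μ ≤ ∫⁻ x, (ENNReal.ofReal (f x) + ENNReal.ofReal (-f x)) ∂μ := by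
        refine lintegral_mono fun x => ?_
        rw [Real.enorm_eq_ofReal_abs]
        rcases abs_cases (f x) with h | h <;> rw [h.1]
        · exact le_self_add
        · exact le_add_self
    _ = _ := lintegral_add_left' hf.aemeasurable.ennreal_ofReal _
    _ < ⊤ := ENNReal.add_lt_top.2 ⟨h1.lt_top, h2.lt_top⟩

theorem integrable_logDensity {μ : Measure (ι → ℝ)} (h1 : entropyPos μ ≠ ⊤)
    (h2 : entropyNeg μ ≠ ⊤) : Integrable (logDensity μ) μ :=
  integrable_of_lintegral_ofReal_ne_top (measurable_logDensity μ).aestronglyMeasurable h2 h1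

theorem entropyPos_ne_top {μ : Measure (ι → ℝ)} (h : Integrable (logDensity μ) μ) :
    entropyPos μ ≠ ⊤ := h.neg.lintegral_lt_top.ne

theorem entropyNeg_ne_top {μ : Measure (ι → ℝ)} (h : Integrable (logDensity μ) μ) :
    entropyNeg μ ≠ ⊤ := h.lintegral_lt_top.ne

theorem shannonEntropy_eq {μ : Measure (ι → ℝ)} (h : Integrable (logDensity μ) μ) :
    shannonEntropy μ = ((-∫ x, logDensity μ x ∂μ : ℝ) : EReal) := by
  have h1 := entropyPos_ne_top h
  have h2 := entropyNeg_ne_top h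
  rw [shannonEntropy, integral_eq_lintegral_pos_part_sub_lintegral_neg_part h,
    ← EReal.coe_ennreal_toReal h1, ← EReal.coe_ennreal_toReal h2, ← EReal.coe_sub]
  congr 1
  simp only [entropyPos, entropyNeg]
  ring

theorem entropyPos_ne_top_of_shannonEntropy_ne_top {μ : Measure (ι → ℝ)} (h : HasEntropy μ)
    (ht : shannonEntropy μ ≠ ⊤) : entropyPos μ ≠ ⊤ := by
  intro h1
  have h2 := h.2.resolve_left (fun hn => hn h1)
  apply ht
  rw [shannonEntropy, h1, ← EReal.coe_ennreal_toReal h2, EReal.coe_ennreal_top,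
    EReal.top_sub_coe]

/-- Summands whose sum has an integrable upper bound and whose negative parts are integrable are
integrable. -/
theorem integrable_of_sum_le {α κ : Type*} [Fintype κ] {mα : MeasurableSpace α} {μ : Measure α}
    {y : κ → α → ℝ} {R : α → ℝ} (hy : ∀ i, AEStronglyMeasurable (y i) μ)
    (hneg : ∀ i, ∫⁻ x, ENNReal.ofReal (-y i x) ∂μ ≠ ⊤) (hR : Integrable R μ)
    (hle : ∀ᵐ x ∂μ, ∑ i, y i x ≤ R x) (i : κ) : Integrable (y i) μ := by
  have hmax : ∀ j, Integrable (fun x => max (-y j x) 0) μ := by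
    intro j
    refine integrable_of_lintegral_ofReal_ne_top ((hy j).neg.sup aestronglyMeasurable_const) ?_ ?_
    · convert hneg j using 3 with x
      rcases le_total (-y j x) 0 with h | h
      · rw [max_eq_right h, ENNReal.ofReal_of_nonpos h, ENNReal.ofReal_zero]
      · rw [max_eq_left h]
    · have : ∀ x, ENNReal.ofReal (-max (-y j x) 0) = 0 := fun x =>
        ENNReal.ofReal_of_nonpos (by simp)
      simp [this]
  refine Integrable.mono' (hR.abs.add (integrable_finsetSum Finset.univ fun j _ => hmax j))
    (hy i) ?_
  filter_upwards [hle] with x hx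
  have h0 : ∀ j, 0 ≤ max (-y j x) 0 := fun j => le_max_right _ _
  have h1 : ∀ j, 0 ≤ y j x + max (-y j x) 0 := fun j => by
    have := le_max_left (-y j x) 0; linarith
  have h2 : max (-y i x) 0 ≤ ∑ j, max (-y j x) 0 :=
    Finset.single_le_sum (f := fun j => max (-y j x) 0) (fun j _ => h0 j) (Finset.mem_univ i)
  -- The positive part of one summand is at most the sum of all positive parts, hence at most R plus
  -- the sum of all negative parts.
  have h3 : y i x + max (-y i x) 0 ≤ ∑ j, (y j x + max (-y j x) 0) :=
    Finset.single_le_sum (f := fun j => y j x + max (-y j x) 0) (fun j _ => h1 j)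
      (Finset.mem_univ i)
  rw [Finset.sum_add_distrib] at h3
  have h4 := le_abs_self (R x)
  have h5 := abs_nonneg (R x)
  have h6 := le_max_left (-y i x) 0
  have h7 := h0 i
  simp only [Pi.add_apply, Real.norm_eq_abs]
  rw [abs_le]
  constructor <;> linarith

theorem ereal_coe_sum {κ : Type*} (s : Finset κ) (a : κ → ℝ) :
    ((∑ i ∈ s, a i : ℝ) : EReal) = ∑ i ∈ s, (a i : EReal) := by
  classical
  induction s using Finset.induction_on with
  | empty => simp
  | insert i s hi ih => rw [Finset.sum_insert hi, Finset.sum_insert hi, EReal.coe_add, ih]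

theorem ereal_sum_eq_top {κ : Type*} [Fintype κ] {a : κ → EReal} (hb : ∀ i, a i ≠ ⊥)
    (ht : ∃ i, a i = ⊤) : ∑ i, a i = ⊤ := by
  classical
  obtain ⟨i, hi⟩ := ht
  rw [← Finset.add_sum_erase _ _ (Finset.mem_univ i), hi]
  apply EReal.top_add_of_ne_bot
  refine Finset.sum_induction a (fun x => x ≠ ⊥) (fun x y hx hy => ?_) (by simp) fun j _ => hb j
  exact EReal.add_ne_bot_iff.2 ⟨hx, hy⟩

variable {K : ℕ} {d : Fin K → ℕ}

theorem ofReal_rpow_le_inv_of_mul_le_one {c p : ℝ} (hc : 0 < c) (hp : 0 ≤ p) {a : ℝ≥0∞}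
    (h : ENNReal.ofReal c * a ≤ 1) : a ^ p ≤ ENNReal.ofReal (c ^ (-p)) := by
  have h1 : a ≤ ENNReal.ofReal c⁻¹ := by
    rw [ENNReal.ofReal_inv_of_pos hc, ← one_div,
      ENNReal.le_div_iff_mul_le (Or.inl (by simpa using hc)) (Or.inl ENNReal.ofReal_ne_top),
      mul_comm]
    exact h
  calc a ^ p ≤ ENNReal.ofReal c⁻¹ ^ p := ENNReal.rpow_le_rpow h1 hp
    _ = _ := by
      rw [ENNReal.ofReal_rpow_of_pos (by positivity), Real.rpow_neg hc.le, Real.inv_rpow hc.le]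

/-- The constant is the same for the reference measures as for Lebesgue measure: by `hdim` the
powers of 2π cancel. -/
theorem Datum.lintegral_prod_rnDeriv_le (D : Datum ι K d) {p : Fin K → ℝ} (hp : ∀ i, 0 ≤ p i)
    (hdim : (Fintype.card ι : ℝ) = ∑ i, p i * (d i : ℝ)) {C : ℝ≥0∞}
    (hC : ∀ f : (i : Fin K) → (Fin (d i) → ℝ) → ℝ≥0∞, (∀ i, Measurable (f i)) →
      ∫⁻ x : ι → ℝ, ∏ i, f i ((D.B i).mulVec x) ^ p i ≤ C * ∏ i, (∫⁻ x, f i x) ^ p i)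
    (ν : (i : Fin K) → Measure (Fin (d i) → ℝ)) [∀ i, IsProbabilityMeasure (ν i)] :
    ∫⁻ x, ∏ i, (ν i).rnDeriv (refMeasure _) ((D.B i).mulVec x) ^ p i ∂(refMeasure ι) ≤ C := by
  set c : ℕ → ℝ := fun k => (2 * Real.pi) ^ (-(k : ℝ) / 2) with hc
  have hc0 : ∀ k, 0 < c k := fun k => by positivity
  have h1 : ∀ i, (∫⁻ x, (ν i).rnDeriv (refMeasure _) x) ^ p i ≤
      ENNReal.ofReal (c (d i) ^ (-p i)) := by
    intro i
    refine ofReal_rpow_le_inv_of_mul_le_one (hc0 _) (hp i) ?_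
    have h2 := Measure.lintegral_rnDeriv_le (μ := ν i) (ν := refMeasure (Fin (d i)))
    rw [lintegral_refMeasure, measure_univ, Fintype.card_fin] at h2
    exact h2
  have h3 : c (Fintype.card ι) * ∏ i, c (d i) ^ (-p i) = 1 := by
    have h4 : ∀ i, c (d i) ^ (-p i) = (2 * Real.pi) ^ (p i * (d i : ℝ) / 2) := by
      intro i
      rw [hc, ← Real.rpow_mul (by positivity)]
      congr 1; ring
    simp_rw [h4]
    rw [← Real.rpow_sum_of_pos (by positivity), hc, ← Real.rpow_add (by positivity),
      ← Finset.sum_div, ← hdim]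
    rw [show -(Fintype.card ι : ℝ) / 2 + (Fintype.card ι : ℝ) / 2 = 0 by ring, Real.rpow_zero]
  rw [lintegral_refMeasure]
  calc _ ≤ ENNReal.ofReal (c (Fintype.card ι)) *
        (C * ∏ i, (∫⁻ x, (ν i).rnDeriv (refMeasure _) x) ^ p i) := by
        gcongr
        exact hC _ fun i => Measure.measurable_rnDeriv _ _
    _ ≤ ENNReal.ofReal (c (Fintype.card ι)) * (C * ∏ i, ENNReal.ofReal (c (d i) ^ (-p i))) := by
        gcongr with i
        exact h1 i
    _ = C * ENNReal.ofReal (c (Fintype.card ι) * ∏ i, c (d i) ^ (-p i)) := by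
        rw [ENNReal.ofReal_mul (hc0 _).le,
          ENNReal.ofReal_prod_of_nonneg fun i _ => (Real.rpow_pos_of_pos (hc0 _) _).le]
        ring
    _ = C := by rw [h3, ENNReal.ofReal_one, mul_one]

/-- A functional Brascamp--Lieb inequality implies an entropy inequality. -/
theorem Datum.constant_le (D : Datum ι K d) {p : Fin K → ℝ} (hp : ∀ i, 0 ≤ p i)
    (hdim : (Fintype.card ι : ℝ) = ∑ i, p i * (d i : ℝ)) {C : ℝ}
    (hC : ∀ f : (i : Fin K) → (Fin (d i) → ℝ) → ℝ≥0∞, (∀ i, Measurable (f i)) →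
      ∫⁻ x : ι → ℝ, ∏ i, f i ((D.B i).mulVec x) ^ p i ≤
        ENNReal.ofReal (Real.exp C) * ∏ i, (∫⁻ x, f i x) ^ p i) :
    D.constant p ≤ C := by
  refine iSup₂_le fun μ hμ => ?_
  obtain ⟨hprob, ⟨hac, hpos, hneg⟩, hwd, hinf⟩ := hμ
  have hBm : ∀ i, Measurable (fun x : ι → ℝ => (D.B i).mulVec x) := fun i =>
    (Continuous.matrix_mulVec continuous_const continuous_id).measurable
  have hprob' : ∀ i, IsProbabilityMeasure (D.outputLaw μ i) := fun i =>
    Measure.isProbabilityMeasure_map (hBm i).aemeasurable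
  have hint := integrable_logDensity hpos hneg
  rw [shannonEntropy_eq hint]
  -- If some output entropy is +∞, well-definedness excludes -∞, the weighted sum is +∞ and the
  -- difference is -∞.
  by_cases htop : ∃ i, p i ≠ 0 ∧ shannonEntropy (D.outputLaw μ i) = ⊤
  · have : ∑ i, (p i : EReal) * shannonEntropy (D.outputLaw μ i) = ⊤ := by
      apply ereal_sum_eq_top
      · intro i
        by_cases hpi : p i = 0
        · simp [hpi]
        · have hb : shannonEntropy (D.outputLaw μ i) ≠ ⊥ := by
            obtain ⟨j, hj, hjt⟩ := htop
            exact fun h => hinf ⟨j, i, hj, hpi, hjt, h⟩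
          have hpi' : 0 < p i := lt_of_le_of_ne (hp i) (Ne.symm hpi)
          rw [Ne, EReal.mul_eq_bot]
          rintro (h | h | h | h)
          · exact EReal.coe_ne_bot _ h.1
          · exact hb h.2
          · exact EReal.coe_ne_top _ h.1
          · exact absurd h.1 (not_lt.2 (EReal.coe_nonneg.2 hpi'.le))
      · obtain ⟨i, hi, hit⟩ := htop
        refine ⟨i, ?_⟩
        rw [hit, EReal.coe_mul_top_of_pos (lt_of_le_of_ne (hp i) (Ne.symm hi))]
    rw [this, EReal.sub_top]
    exact bot_le
  push Not at htop
  set g := μ.rnDeriv (refMeasure ι) with hg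
  set f := fun i => (D.outputLaw μ i).rnDeriv (refMeasure (Fin (d i))) with hf
  have hgm : Measurable g := Measure.measurable_rnDeriv _ _
  have hfm : ∀ i, Measurable (f i) := fun i => Measure.measurable_rnDeriv _ _
  have hac' : μ ≪ refMeasure ι := hac.trans absolutelyContinuous_refMeasure
  set P : (ι → ℝ) → ℝ≥0∞ := fun x => ∏ i, f i ((D.B i).mulVec x) ^ p i with hP
  have hPm : Measurable P := by
    refine Finset.measurable_prod _ fun i _ => ?_
    exact ((hfm i).comp (hBm i)).pow_const _
  have hPle : ∫⁻ x, P x ∂(refMeasure ι) ≤ ENNReal.ofReal (Real.exp C) :=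
    D.lintegral_prod_rnDeriv_le hp hdim hC (fun i => D.outputLaw μ i)
  have hPgm : Measurable (fun x => P x / g x) := hPm.div hgm
  -- Only an inequality, since g · (P/g) may be smaller than P where g is 0 or ∞.
  have hu : ∫⁻ x, P x / g x ∂μ ≤ ENNReal.ofReal (Real.exp C) := by
    rw [← lintegral_rnDeriv_mul hac' hPgm.aemeasurable]
    refine (lintegral_mono fun x => ?_).trans hPle
    exact ENNReal.mul_div_le
  have huf : ∫⁻ x, P x / g x ∂μ ≠ ⊤ := (hu.trans_lt ENNReal.ofReal_lt_top).ne
  have hui : Integrable (fun x => (P x / g x).toReal) μ :=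
    integrable_toReal_of_lintegral_ne_top hPgm.aemeasurable huf
  have huint : ∫ x, (P x / g x).toReal ∂μ ≤ Real.exp C := by
    rw [integral_toReal hPgm.aemeasurable (ae_lt_top hPgm huf)]
    exact ENNReal.toReal_le_of_le_ofReal (Real.exp_pos C).le hu
  set y : Fin K → (ι → ℝ) → ℝ := fun i x =>
    p i * logDensity (D.outputLaw μ i) ((D.B i).mulVec x) with hy
  -- Jensen's inequality in pointwise form: ln t ≤ t - 1 at t = e^(-C) P/g gives ∑ yᵢ ≤ R. Unlike
  -- the integrated form it does not presuppose that the yᵢ are integrable.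
  set R : (ι → ℝ) → ℝ := fun x =>
    logDensity μ x + ((P x / g x).toReal * Real.exp (-C) + (C - 1)) with hR
  have hRi' : Integrable (fun x => (P x / g x).toReal * Real.exp (-C) + (C - 1)) μ :=
    (hui.mul_const _).add (integrable_const _)
  have hRi : Integrable R μ := hint.add hRi'
  have hle : ∀ᵐ x ∂μ, ∑ i, y i x ≤ R x := by
    have hfae : ∀ᵐ x ∂μ, ∀ i, p i ≠ 0 →
        0 < f i ((D.B i).mulVec x) ∧ f i ((D.B i).mulVec x) < ⊤ := by
      rw [ae_all_iff]
      intro i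
      by_cases hpi : p i = 0
      · simp [hpi]
      have haci : D.outputLaw μ i ≪ refMeasure (Fin (d i)) :=
        (hwd i hpi).1.trans absolutelyContinuous_refMeasure
      have h1 := (Measure.rnDeriv_pos haci).and
        (haci.ae_le (Measure.rnDeriv_lt_top (D.outputLaw μ i) (refMeasure (Fin (d i)))))
      filter_upwards [ae_of_ae_map (hBm i).aemeasurable h1] with x hx _ using hx
    filter_upwards [hfae, Measure.rnDeriv_pos hac',
      hac'.ae_le (Measure.rnDeriv_lt_top μ (refMeasure ι))] with x hx hg0 hgt
    have hfi : ∀ i, 0 < (f i ((D.B i).mulVec x) ^ p i).toReal ∧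
        Real.log (f i ((D.B i).mulVec x) ^ p i).toReal = y i x := by
      intro i
      by_cases hpi : p i = 0
      · simp [hpi, hy]
      · have h1 := ENNReal.toReal_pos (hx i hpi).1.ne' (hx i hpi).2.ne
        rw [← ENNReal.toReal_rpow]
        exact ⟨Real.rpow_pos_of_pos h1 _, Real.log_rpow h1 _⟩
    have hPx : (P x).toReal = ∏ i, (f i ((D.B i).mulVec x) ^ p i).toReal := ENNReal.toReal_prod _ _
    have hPpos : 0 < (P x).toReal := by
      rw [hPx]; exact Finset.prod_pos fun i _ => (hfi i).1
    have hgpos : 0 < (g x).toReal := ENNReal.toReal_pos hg0.ne' hgt.ne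
    have hlogP : Real.log (P x).toReal = ∑ i, y i x := by
      rw [hPx, Real.log_prod fun i _ => (hfi i).1.ne']
      exact Finset.sum_congr rfl fun i _ => (hfi i).2
    have hlogu : Real.log ((P x / g x).toReal * Real.exp (-C)) =
        ∑ i, y i x - logDensity μ x - C := by
      rw [ENNReal.toReal_div, Real.log_mul (div_pos hPpos hgpos).ne' (Real.exp_pos _).ne',
        Real.log_div hPpos.ne' hgpos.ne', hlogP, Real.log_exp]
      rfl
    have hk := Real.log_le_sub_one_of_pos (x := (P x / g x).toReal * Real.exp (-C)) (by
      rw [ENNReal.toReal_div]; positivity)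
    simp only [hR]
    linarith
  have hym : ∀ i, AEStronglyMeasurable (y i) μ := fun i =>
    (((measurable_logDensity _).comp (hBm i)).const_mul _).aestronglyMeasurable
  have hyneg : ∀ i, ∫⁻ x, ENNReal.ofReal (-y i x) ∂μ ≠ ⊤ := by
    intro i
    by_cases hpi : p i = 0
    · simp [hy, hpi]
    have h1 := entropyPos_ne_top_of_shannonEntropy_ne_top (hwd i hpi) (htop i hpi)
    rw [entropyPos] at h1
    have h2 : ∀ x, ENNReal.ofReal (-y i x) = ENNReal.ofReal (p i) *
        ENNReal.ofReal (-logDensity (D.outputLaw μ i) ((D.B i).mulVec x)) := by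
      intro x
      rw [← ENNReal.ofReal_mul (hp i)]
      simp only [hy, mul_neg]
    simp_rw [h2]
    rw [lintegral_const_mul' _ _ ENNReal.ofReal_ne_top]
    refine ENNReal.mul_ne_top ENNReal.ofReal_ne_top ?_
    rwa [← lintegral_map (f := fun z => ENNReal.ofReal (-logDensity (D.outputLaw μ i) z))
      (measurable_logDensity _).neg.ennreal_ofReal (hBm i)]
  -- Hence the output entropies with nonzero coefficients are finite: +∞ was excluded above, and the
  -- bound by `R` excludes -∞.
  have hyi := integrable_of_sum_le hym hyneg hRi hle
  have hSi : ∀ i, (p i : EReal) * shannonEntropy (D.outputLaw μ i) =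
      ((-∫ x, y i x ∂μ : ℝ) : EReal) := by
    intro i
    by_cases hpi : p i = 0
    · simp [hy, hpi]
    have h1 : Integrable (logDensity (D.outputLaw μ i)) (D.outputLaw μ i) := by
      rw [Datum.outputLaw, integrable_map_measure
        (measurable_logDensity _).aestronglyMeasurable (hBm i).aemeasurable]
      exact (integrable_const_mul_iff (isUnit_iff_ne_zero.2 hpi) _).1 (hyi i)
    rw [shannonEntropy_eq h1, ← EReal.coe_mul]
    congr 1
    simp only [hy]
    rw [integral_const_mul]
    conv_lhs => rw [Datum.outputLaw, integral_map (hBm i).aemeasurable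
      (measurable_logDensity _).aestronglyMeasurable]
    rw [Datum.outputLaw]
    ring
  simp_rw [hSi]
  rw [← ereal_coe_sum, ← EReal.coe_sub, EReal.coe_le_coe_iff, Finset.sum_neg_distrib,
    ← integral_finsetSum _ fun i _ => hyi i]
  have hfin := integral_mono_ae (integrable_finsetSum _ fun i _ => hyi i) hRi hle
  have hRint : ∫ x, R x ∂μ = ∫ x, logDensity μ x ∂μ +
      ((∫ x, (P x / g x).toReal ∂μ) * Real.exp (-C) + (C - 1)) := by
    simp only [hR]
    rw [integral_add hint hRi', integral_add (hui.mul_const _) (integrable_const _),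
      integral_mul_const]
    simp
  have hE : (∫ x, (P x / g x).toReal ∂μ) * Real.exp (-C) ≤ 1 := by
    calc _ ≤ Real.exp C * Real.exp (-C) := by gcongr
      _ = 1 := by rw [← Real.exp_add, add_neg_cancel, Real.exp_zero]
  rw [hRint] at hfin
  linarith

end Entropy

open ProbabilityTheory

/-! ### Entropies of Gaussian laws and their linear images -/

section Gaussian

variable {ι : Type} [Fintype ι]

theorem entropy_of_eq_withDensity {μ : Measure (ι → ℝ)} {q : (ι → ℝ) → ℝ} (hq : Measurable q)
    (hμ : μ = (refMeasure ι).withDensity fun x => ENNReal.ofReal (Real.exp (-q x)))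
    (hi : Integrable q μ) :
    HasFiniteEntropy μ ∧ shannonEntropy μ = ((∫ x, q x ∂μ : ℝ) : EReal) := by
  have hac : μ ≪ refMeasure ι := by
    rw [hμ]; exact withDensity_absolutelyContinuous _ _
  have hrv : refMeasure ι ≪ volume := Measure.smul_absolutelyContinuous
  have hm : Measurable fun x => ENNReal.ofReal (Real.exp (-q x)) := by fun_prop
  have h1 : μ.rnDeriv (refMeasure ι) =ᵐ[refMeasure ι]
      fun x => ENNReal.ofReal (Real.exp (-q x)) := by
    conv_lhs => rw [hμ]
    exact Measure.rnDeriv_withDensity _ hm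
  have h2 : logDensity μ =ᵐ[μ] fun x => -q x := by
    filter_upwards [hac.ae_eq h1] with x hx
    rw [logDensity, hx, ENNReal.toReal_ofReal (Real.exp_pos _).le, Real.log_exp]
  have h3 : Integrable (logDensity μ) μ := hi.neg.congr h2.symm
  refine ⟨⟨hac.trans hrv, entropyPos_ne_top h3, entropyNeg_ne_top h3⟩, ?_⟩
  rw [shannonEntropy_eq h3, integral_congr_ae h2, integral_neg, neg_neg]

/-- Minus the logarithm of the density of the centred Gaussian law with variance `v` in each
coordinate. -/
noncomputable def gaussianPotential (v : ℝ) (x : ι → ℝ) : ℝ :=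
  ∑ i, x i ^ 2 / (2 * v) + (Fintype.card ι : ℝ) / 2 * Real.log v

theorem measurable_gaussianPotential (v : ℝ) :
    Measurable (gaussianPotential v : (ι → ℝ) → ℝ) := by
  unfold gaussianPotential
  fun_prop

theorem prod_gaussianPDFReal_eq {v : NNReal} (hv : v ≠ 0) (x : ι → ℝ) :
    ∏ i, gaussianPDFReal 0 v (x i) =
      (2 * Real.pi) ^ (-(Fintype.card ι : ℝ) / 2) * Real.exp (-gaussianPotential v x) := by
  have hv' : (0 : ℝ) < v := NNReal.coe_pos.2 (pos_iff_ne_zero.2 hv)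
  have h2 : (0 : ℝ) < 2 * Real.pi := by positivity
  simp only [gaussianPDFReal, sub_zero]
  rw [Finset.prod_mul_distrib, Finset.prod_const, ← Real.exp_sum, Finset.card_univ,
    Real.rpow_def_of_pos h2, ← Real.exp_add]
  have h1 : (√(2 * Real.pi * v))⁻¹ =
      Real.exp (-(Real.log (2 * Real.pi) + Real.log v) / 2) := by
    have := inv_sqrt_rpow (p := 1) hv'
    rwa [Real.rpow_one, one_mul] at this
  rw [h1, ← Real.exp_nat_mul, ← Real.exp_add, gaussianPotential]
  congr 1
  have h3 : ∑ i, -x i ^ 2 / (2 * (v : ℝ)) = -∑ i, x i ^ 2 / (2 * (v : ℝ)) := by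
    rw [← Finset.sum_neg_distrib]
    exact Finset.sum_congr rfl fun i _ => by ring
  rw [h3]
  ring

/-- A product measure is determined by its values on boxes, where the integral of the density
factors. -/
theorem pi_gaussianReal_eq_withDensity {v : NNReal} (hv : v ≠ 0) :
    Measure.pi (fun _ : ι => gaussianReal 0 v) = (refMeasure ι).withDensity
      fun x => ENNReal.ofReal (Real.exp (-gaussianPotential v x)) := by
  have hm : Measurable fun x : ι → ℝ => ENNReal.ofReal (Real.exp (-gaussianPotential v x)) :=
    (measurable_gaussianPotential v).neg.exp.ennreal_ofReal
  refine Measure.pi_eq fun s hs => ?_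
  have hbox : MeasurableSet (univ.pi s) := MeasurableSet.univ_pi hs
  have hint : ∀ i, Integrable ((s i).indicator (gaussianPDFReal 0 v)) := fun i =>
    (integrable_gaussianPDFReal 0 v).indicator (hs i)
  have hnn : ∀ i t, 0 ≤ (s i).indicator (gaussianPDFReal 0 v) t := fun i t =>
    indicator_nonneg (fun t _ => gaussianPDFReal_nonneg 0 v t) t
  rw [withDensity_apply _ hbox, ← lintegral_indicator hbox, lintegral_refMeasure,
    ← lintegral_const_mul _ (hm.indicator hbox)]
  have hpt : ∀ x : ι → ℝ, ENNReal.ofReal ((2 * Real.pi) ^ (-(Fintype.card ι : ℝ) / 2)) *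
      (univ.pi s).indicator (fun x => ENNReal.ofReal (Real.exp (-gaussianPotential v x))) x =
      ENNReal.ofReal (∏ i, (s i).indicator (gaussianPDFReal 0 v) (x i)) := by
    intro x
    by_cases hx : x ∈ univ.pi s
    · rw [indicator_of_mem hx, ← ENNReal.ofReal_mul (refMeasure_const_pos ι).le,
        ← prod_gaussianPDFReal_eq hv]
      congr 1
      exact Finset.prod_congr rfl fun i _ => (indicator_of_mem (hx i (mem_univ i)) _).symm
    · rw [indicator_of_notMem hx, mul_zero]
      simp only [Set.mem_pi, mem_univ, true_implies, not_forall] at hx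
      obtain ⟨i, hi⟩ := hx
      rw [Finset.prod_eq_zero (Finset.mem_univ i) (indicator_of_notMem hi _), ENNReal.ofReal_zero]
  simp_rw [hpt]
  rw [volume_pi, ← ofReal_integral_eq_lintegral_ofReal (Integrable.fintype_prod_dep hint)
    (Eventually.of_forall fun x => Finset.prod_nonneg fun i _ => hnn i _),
    integral_fintype_prod_eq_prod, ENNReal.ofReal_prod_of_nonneg
      fun i _ => integral_nonneg (hnn i)]
  refine Finset.prod_congr rfl fun i _ => ?_
  rw [gaussianReal_apply_eq_integral 0 hv, integral_indicator (hs i)]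

theorem integrable_gaussianPotential {v : NNReal} :
    Integrable (gaussianPotential v) (Measure.pi (fun _ : ι => gaussianReal 0 v)) := by
  refine Integrable.add (integrable_finsetSum _ fun i _ => ?_) (integrable_const _)
  have h2 : Integrable (fun t : ℝ => t ^ 2 / (2 * (v : ℝ))) (gaussianReal 0 v) :=
    ((memLp_id_gaussianReal' 2 (by simp)).integrable_sq).div_const _
  exact integrable_comp_eval (μ := fun _ : ι => gaussianReal 0 v) (i := i) h2

theorem integral_sq_gaussianReal (v : NNReal) : ∫ t, t ^ 2 ∂(gaussianReal 0 v) = v := by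
  have h := variance_of_integral_eq_zero (μ := gaussianReal 0 v) (X := fun t : ℝ => t)
    (by fun_prop) integral_id_gaussianReal
  rw [← h, variance_fun_id_gaussianReal]

theorem integral_gaussianPotential {v : NNReal} (hv : v ≠ 0) :
    ∫ x, gaussianPotential v x ∂(Measure.pi (fun _ : ι => gaussianReal 0 v)) =
      (Fintype.card ι : ℝ) / 2 * (Real.log v + 1) := by
  have h2 : Integrable (fun t : ℝ => t ^ 2 / (2 * (v : ℝ))) (gaussianReal 0 v) :=
    ((memLp_id_gaussianReal' 2 (by simp)).integrable_sq).div_const _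
  have h3 : ∀ i : ι, Integrable (fun x : ι → ℝ => x i ^ 2 / (2 * (v : ℝ)))
      (Measure.pi (fun _ : ι => gaussianReal 0 v)) := fun i =>
    integrable_comp_eval (μ := fun _ : ι => gaussianReal 0 v) (i := i) h2
  have h4 : ∀ i : ι, ∫ x : ι → ℝ, x i ^ 2 / (2 * (v : ℝ))
      ∂(Measure.pi (fun _ : ι => gaussianReal 0 v)) = 1 / 2 := by
    intro i
    have := integral_comp_eval (μ := fun _ : ι => gaussianReal 0 v) (i := i)
      h2.aestronglyMeasurable
    rw [this, integral_div, integral_sq_gaussianReal]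
    have : (v : ℝ) ≠ 0 := NNReal.coe_ne_zero.2 hv
    field_simp
  simp only [gaussianPotential]
  rw [integral_add (integrable_finsetSum _ fun i _ => h3 i) (integrable_const _),
    integral_finsetSum _ fun i _ => h3 i]
  simp only [h4, Finset.sum_const, integral_const, Finset.card_univ]
  simp
  ring

theorem entropy_pi_gaussianReal {v : NNReal} (hv : v ≠ 0) :
    HasFiniteEntropy (Measure.pi (fun _ : ι => gaussianReal 0 v)) ∧
      shannonEntropy (Measure.pi (fun _ : ι => gaussianReal 0 v)) =
        (((Fintype.card ι : ℝ) / 2 * (Real.log v + 1) : ℝ) : EReal) := by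
  rw [← integral_gaussianPotential hv]
  exact entropy_of_eq_withDensity (measurable_gaussianPotential v)
    (pi_gaussianReal_eq_withDensity hv) integrable_gaussianPotential

theorem map_mulVec_withDensity [DecidableEq ι] {M : Matrix ι ι ℝ} (hM : M.det ≠ 0)
    {q : (ι → ℝ) → ℝ} (hq : Measurable q) :
    ((refMeasure ι).withDensity fun x => ENNReal.ofReal (Real.exp (-q x))).map M.mulVec =
      (refMeasure ι).withDensity fun x =>
        ENNReal.ofReal (Real.exp (-(q (M⁻¹.mulVec x) + Real.log |M.det|))) := by
  have hMm : Measurable M.mulVec :=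
    (Continuous.matrix_mulVec continuous_const continuous_id).measurable
  have hMm' : Measurable M⁻¹.mulVec :=
    (Continuous.matrix_mulVec continuous_const continuous_id).measurable
  have hmap : (refMeasure ι).map M.mulVec = ENNReal.ofReal |M.det⁻¹| • refMeasure ι := by
    have h := Real.map_matrix_volume_pi_eq_smul_volume_pi hM
    rw [refMeasure, Measure.map_smul, smul_comm]
    congr 1
  have hinv : ∀ x, M⁻¹.mulVec (M.mulVec x) = x := fun x => by
    rw [Matrix.mulVec_mulVec, Matrix.nonsing_inv_mul _ (isUnit_iff_ne_zero.2 hM),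
      Matrix.one_mulVec]
  have hF : Measurable fun x : ι → ℝ => ENNReal.ofReal (Real.exp (-q (M⁻¹.mulVec x))) :=
    (hq.comp hMm').neg.exp.ennreal_ofReal
  ext s hs
  rw [Measure.map_apply hMm hs, withDensity_apply _ (hMm hs), withDensity_apply _ hs]
  have h1 : ∀ x, ENNReal.ofReal (Real.exp (-(q (M⁻¹.mulVec x) + Real.log |M.det|))) =
      ENNReal.ofReal |M.det⁻¹| * ENNReal.ofReal (Real.exp (-q (M⁻¹.mulVec x))) := by
    intro x
    rw [← ENNReal.ofReal_mul (abs_nonneg _), neg_add, Real.exp_add, Real.exp_neg (Real.log _),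
      Real.exp_log (abs_pos.2 hM), abs_inv, mul_comm]
  simp_rw [h1]
  rw [lintegral_const_mul _ hF, ← smul_eq_mul, ← lintegral_smul_measure,
    ← Measure.restrict_smul, ← hmap, setLIntegral_map hs hF hMm]
  simp_rw [hinv]

theorem entropy_map_mulVec [DecidableEq ι] {M : Matrix ι ι ℝ} (hM : M.det ≠ 0)
    {μ : Measure (ι → ℝ)} {q : (ι → ℝ) → ℝ} (hq : Measurable q) [IsProbabilityMeasure μ]
    (hμ : μ = (refMeasure ι).withDensity fun x => ENNReal.ofReal (Real.exp (-q x)))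
    (hi : Integrable q μ) :
    HasFiniteEntropy (μ.map M.mulVec) ∧
      shannonEntropy (μ.map M.mulVec) = ((∫ x, q x ∂μ + Real.log |M.det| : ℝ) : EReal) := by
  have hMm : Measurable M.mulVec :=
    (Continuous.matrix_mulVec continuous_const continuous_id).measurable
  have hMm' : Measurable M⁻¹.mulVec :=
    (Continuous.matrix_mulVec continuous_const continuous_id).measurable
  have hinv : ∀ x, M⁻¹.mulVec (M.mulVec x) = x := fun x => by
    rw [Matrix.mulVec_mulVec, Matrix.nonsing_inv_mul _ (isUnit_iff_ne_zero.2 hM),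
      Matrix.one_mulVec]
  have hqm : Measurable fun x => q (M⁻¹.mulVec x) + Real.log |M.det| :=
    (hq.comp hMm').add_const _
  have hint : Integrable (fun x => q (M⁻¹.mulVec x) + Real.log |M.det|) (μ.map M.mulVec) := by
    rw [integrable_map_measure hqm.aestronglyMeasurable hMm.aemeasurable]
    simp only [Function.comp_def, hinv]
    exact hi.add (integrable_const _)
  have hval : ∫ x, (q (M⁻¹.mulVec x) + Real.log |M.det|) ∂(μ.map M.mulVec) =
      ∫ x, q x ∂μ + Real.log |M.det| := by
    rw [integral_map hMm.aemeasurable hqm.aestronglyMeasurable]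
    simp only [hinv]
    rw [integral_add hi (integrable_const _)]
    simp
  rw [← hval]
  refine entropy_of_eq_withDensity hqm ?_ hint
  conv_lhs => rw [hμ]
  exact map_mulVec_withDensity hM hq

theorem map_prod_gaussianReal (r s : ℝ) :
    ((gaussianReal 0 1).prod (gaussianReal 0 1)).map (fun z : ℝ × ℝ => r * z.1 + s * z.2) =
      gaussianReal 0 (Real.toNNReal (r ^ 2 + s ^ 2)) := by
  have h1 : (fun z : ℝ × ℝ => r * z.1 + s * z.2) =
      (fun z : ℝ × ℝ => z.1 + z.2) ∘ Prod.map (fun t => r * t) (fun t => s * t) := rfl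
  rw [h1, ← Measure.map_map (by fun_prop) (by fun_prop),
    ← Measure.map_prod_map _ _ (by fun_prop) (by fun_prop), gaussianReal_map_const_mul,
    gaussianReal_map_const_mul]
  change Measure.conv _ _ = _
  rw [gaussianReal_conv_gaussianReal]
  congr 1
  · simp
  · rw [Real.toNNReal_add (sq_nonneg r) (sq_nonneg s)]
    simp only [mul_one]
    congr 1 <;> (apply NNReal.coe_injective; rw [Real.coe_toNNReal _ (sq_nonneg _)]; rfl)

/-- Regrouping the 2n coordinates into n independent pairs reduces this to the sum of two
independent Gaussians. -/
theorem map_pi_gaussianReal {n : ℕ} (r s : ℝ) :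
    (Measure.pi (fun _ : Fin n ⊕ Fin n => gaussianReal 0 1)).map
        (fun z i => r * z (Sum.inl i) + s * z (Sum.inr i)) =
      Measure.pi (fun _ : Fin n => gaussianReal 0 (Real.toNNReal (r ^ 2 + s ^ 2))) := by
  have h1 := measurePreserving_sumPiEquivProdPi (fun _ : Fin n ⊕ Fin n => gaussianReal 0 1)
  have h2 := (measurePreserving_arrowProdEquivProdArrow ℝ ℝ (Fin n)
    (fun _ => gaussianReal 0 1) (fun _ => gaussianReal 0 1)).symm
  have h3 := h2.comp h1
  have h4 := Measure.pi_map_pi (μ := fun _ : Fin n => (gaussianReal 0 1).prod (gaussianReal 0 1))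
    (f := fun _ => fun z : ℝ × ℝ => r * z.1 + s * z.2)
    (fun _ => Measurable.aemeasurable (by fun_prop))
  simp only [map_prod_gaussianReal] at h4
  rw [← h4, ← h3.map_eq, Measure.map_map (by fun_prop) h3.measurable]
  rfl

end Gaussian

/-! ### Gaussian lower bounds, Young upper bounds, and where they meet -/

section Bounds

theorem exists_gaussian_datumZero (n : ℕ) {α β γ : ℝ} (hα : 0 < α) (hD : 0 < α * β - γ ^ 2) :
    ∃ μ : Measure (Fin n ⊕ Fin n → ℝ), IsProbabilityMeasure μ ∧ HasFiniteEntropy μ ∧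
      shannonEntropy μ = (((n : ℝ) / 2 * Real.log (α * β - γ ^ 2) + n : ℝ) : EReal) ∧
      ∀ i, HasFiniteEntropy ((datumZero n).outputLaw μ i) ∧
        shannonEntropy ((datumZero n).outputLaw μ i) =
          (((n : ℝ) / 2 * (Real.log ((![α, β, α + β + 2 * γ] : Fin 3 → ℝ) i) + 1) : ℝ) :
            EReal) := by
  -- Cholesky factorisation: ((a, 0), (b, c)) times its transpose is ((α, γ), (γ, β)), so the test
  -- law is a block triangular image of the standard Gaussian.
  set a := √α with ha
  set b := γ / √α with hb
  set c := √((α * β - γ ^ 2) / α) with hc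
  have ha0 : 0 < a := Real.sqrt_pos.2 hα
  have hc0 : 0 < c := Real.sqrt_pos.2 (div_pos hD hα)
  have ha2 : a ^ 2 = α := Real.sq_sqrt hα.le
  have hab : a * b = γ := mul_div_cancel₀ γ ha0.ne'
  have hc2 : c ^ 2 = (α * β - γ ^ 2) / α := Real.sq_sqrt (div_pos hD hα).le
  have hb2 : b ^ 2 = γ ^ 2 / α := by rw [hb, div_pow, Real.sq_sqrt hα.le]
  have hbc : b ^ 2 + c ^ 2 = β := by rw [hb2, hc2]; field_simp; ring
  set M : Matrix (Fin n ⊕ Fin n) (Fin n ⊕ Fin n) ℝ :=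
    Matrix.fromBlocks (a • 1) 0 (b • 1) (c • 1) with hM
  have hdet : M.det = (a * c) ^ n := by
    rw [hM, Matrix.det_fromBlocks_zero₁₂, Matrix.det_smul, Matrix.det_smul]
    simp [mul_pow]
  have hdet0 : M.det ≠ 0 := by rw [hdet]; positivity
  have hlog : Real.log |M.det| = (n : ℝ) / 2 * Real.log (α * β - γ ^ 2) := by
    have h1 : (a * c) ^ 2 = α * β - γ ^ 2 := by
      rw [mul_pow, ha2, hc2]; field_simp
    rw [hdet, abs_of_pos (by positivity), Real.log_pow, ← h1, Real.log_pow]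
    push_cast
    ring
  set μ₀ : Measure (Fin n ⊕ Fin n → ℝ) := Measure.pi (fun _ => gaussianReal 0 1) with hμ₀
  have hMm : Measurable M.mulVec :=
    (Continuous.matrix_mulVec continuous_const continuous_id).measurable
  obtain ⟨hfin, hS⟩ := entropy_map_mulVec (μ := μ₀) hdet0 (measurable_gaussianPotential _)
    (pi_gaussianReal_eq_withDensity one_ne_zero) integrable_gaussianPotential
  refine ⟨μ₀.map M.mulVec, Measure.isProbabilityMeasure_map hMm.aemeasurable, hfin, ?_, ?_⟩
  · rw [hS, integral_gaussianPotential one_ne_zero, hlog]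
    congr 1
    simp
    ring
  have hMl : ∀ z i, M.mulVec z (Sum.inl i) = a * z (Sum.inl i) := by
    intro z i
    simp [hM, Matrix.fromBlocks_mulVec, Matrix.smul_mulVec]
  have hMr : ∀ z i, M.mulVec z (Sum.inr i) = b * z (Sum.inl i) + c * z (Sum.inr i) := by
    intro z i
    simp [hM, Matrix.fromBlocks_mulVec, Matrix.smul_mulVec]
  have hout : ∀ (i : Fin 3) (r s v : ℝ), r ^ 2 + s ^ 2 = v → 0 < v →
      (∀ z, ((datumZero n).B i).mulVec (M.mulVec z) =
        fun j => r * z (Sum.inl j) + s * z (Sum.inr j)) →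
      HasFiniteEntropy ((datumZero n).outputLaw (μ₀.map M.mulVec) i) ∧
        shannonEntropy ((datumZero n).outputLaw (μ₀.map M.mulVec) i) =
          (((n : ℝ) / 2 * (Real.log v + 1) : ℝ) : EReal) := by
    intro i r s v hv hv0 hz
    have hBm : Measurable (fun x => ((datumZero n).B i).mulVec x) :=
      (Continuous.matrix_mulVec continuous_const continuous_id).measurable
    have h1 : (datumZero n).outputLaw (μ₀.map M.mulVec) i =
        Measure.pi (fun _ : Fin n => gaussianReal 0 (Real.toNNReal v)) := by
      rw [Datum.outputLaw, Measure.map_map hBm hMm, ← hv, ← map_pi_gaussianReal]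
      congr 1
      ext z : 1
      exact hz z
    rw [h1]
    have h2 := entropy_pi_gaussianReal (ι := Fin n) (v := Real.toNNReal v) (by simpa using hv0)
    rwa [Fintype.card_fin, Real.coe_toNNReal _ hv0.le] at h2
  have hβ : 0 < β := by rw [← hbc]; positivity
  intro i
  fin_cases i
  · refine hout 0 a 0 α (by rw [ha2]; ring) hα fun z => ?_
    ext j
    simp [datumZero, Matrix.fromCols_mulVec, -Matrix.mulVec_mulVec, hMl]
  · refine hout 1 b c β hbc hβ fun z => ?_
    ext j
    simp [datumZero, Matrix.fromCols_mulVec, -Matrix.mulVec_mulVec, hMr]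
  · have h3 : (a + b) ^ 2 + c ^ 2 = α + β + 2 * γ := by
      linear_combination ha2 + hbc + 2 * hab
    refine hout 2 (a + b) c (α + β + 2 * γ) h3 (by rw [← h3]; positivity) fun z => ?_
    ext j
    simp [datumZero, Matrix.fromCols_mulVec, -Matrix.mulVec_mulVec, hMl, hMr]
    ring

/-- One Gaussian serves every p: its entropy carries the constant n and each output carries n/2, and
these cancel because ∑ pᵢ = 2. Dividing the dimension constraint by n uses `hn`. -/
theorem le_phi_datumZero {n : ℕ} (hn : 0 < n) {α β γ : ℝ} (hα : 0 < α)
    (hD : 0 < α * β - γ ^ 2) {s : Fin 3 → ℝ}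
    (hs : ∀ i, (n : ℝ) / 2 * Real.log ((![α, β, α + β + 2 * γ] : Fin 3 → ℝ) i) ≤ s i) :
    (((n : ℝ) / 2 * Real.log (α * β - γ ^ 2) : ℝ) : EReal) ≤ (datumZero n).phi s := by
  obtain ⟨μ, hprob, hfin, hS, hout⟩ := exists_gaussian_datumZero n hα hD
  refine le_iInf₂ fun p hp => ?_
  obtain ⟨hp0, hdim⟩ := hp
  have hn' : (0 : ℝ) < n := Nat.cast_pos.2 hn
  have hsum : ∑ i, p i = 2 := by
    rw [← Finset.sum_mul] at hdim
    simp only [Fintype.card_sum, Fintype.card_fin] at hdim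
    push_cast at hdim
    have : (∑ i, p i - 2) * (n : ℝ) = 0 := by linear_combination -hdim
    rcases mul_eq_zero.1 this with h | h
    · linarith
    · exact absurd h hn'.ne'
  have hwd : (datumZero n).WellDefined p μ := by
    refine ⟨fun i _ => ⟨(hout i).1.1, Or.inl (hout i).1.2.1⟩, ?_⟩
    rintro ⟨i, -, -, -, h, -⟩
    rw [(hout i).2] at h
    exact EReal.coe_ne_top _ h
  have hc : shannonEntropy μ - ∑ i, (p i : EReal) * shannonEntropy ((datumZero n).outputLaw μ i) ≤
      (datumZero n).constant p :=
    le_iSup₂ (f := fun (μ : Measure (Fin n ⊕ Fin n → ℝ)) _ => shannonEntropy μ -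
      ∑ i, (p i : EReal) * shannonEntropy ((datumZero n).outputLaw μ i)) μ ⟨hprob, hfin, hwd⟩
  refine le_trans ?_ (add_le_add_right hc _)
  rw [hS]
  simp_rw [fun i => (hout i).2, ← EReal.coe_mul]
  rw [← ereal_coe_sum, ← EReal.coe_sub, ← EReal.coe_add, EReal.coe_le_coe_iff]
  have h1 : ∑ i, p i * ((n : ℝ) / 2 * (Real.log ((![α, β, α + β + 2 * γ] : Fin 3 → ℝ) i) + 1)) ≤
      ∑ i, p i * (s i + (n : ℝ) / 2) := by
    refine Finset.sum_le_sum fun i _ => mul_le_mul_of_nonneg_left ?_ (hp0 i)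
    linarith [hs i]
  have h2 : ∑ i, p i * (s i + (n : ℝ) / 2) = ∑ i, p i * s i + n := by
    simp_rw [mul_add]
    rw [Finset.sum_add_distrib, ← Finset.sum_mul, hsum]
    ring
  linarith

theorem phi_datumZero_le {n : ℕ} {p s : Fin 3 → ℝ} (hp : ∀ i, 0 ≤ p i) (hsum : ∑ i, p i = 2)
    {c : ℝ} (H : HasYoungBound ℝ (p 0) (p 1) (p 2) (ENNReal.ofReal (Real.exp c))) :
    (datumZero n).phi s ≤ ((∑ i, p i * s i + n * c : ℝ) : EReal) := by
  have hdim : (Fintype.card (Fin n ⊕ Fin n) : ℝ) =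
      ∑ i, p i * (((fun _ => n) : Fin 3 → ℕ) i : ℝ) := by
    rw [← Finset.sum_mul, hsum]
    simp only [Fintype.card_sum, Fintype.card_fin]
    push_cast
    ring
  refine (iInf₂_le p ⟨hp, hdim⟩).trans ?_
  rw [EReal.coe_add]
  gcongr
  refine (datumZero n).constant_le hp hdim fun f hf => ?_
  have h1 := H.pi_fin ENNReal.ofReal_ne_top n
  rw [← ENNReal.ofReal_pow (Real.exp_pos c).le, ← Real.exp_nat_mul] at h1
  exact lintegral_prod_datumZero_le h1 f hf

/-- The covariance with output variances A, B, C has off-diagonal entry (C - A - B)/2 and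
determinant D. The strict triangle inequalities say that its inverse is a positive combination of
the bᵢbᵢᵀ, which is what the sharp Young inequality requires. -/
theorem phi_datumZero_eq_of_strictTriangle {n : ℕ} (hn : 0 < n) {s : Fin 3 → ℝ} {A B C : ℝ}
    (hA : 0 < A) (hB : 0 < B) (hC : 0 < C) (h0 : s 0 = (n : ℝ) / 2 * Real.log A)
    (h1 : s 1 = (n : ℝ) / 2 * Real.log B) (h2 : s 2 = (n : ℝ) / 2 * Real.log C)
    (ht : StrictTriangle A B C) :
    (datumZero n).phi s = (((n : ℝ) / 2 * Real.log
      (((B + C - A) * A + (A + C - B) * B + (A + B - C) * C) / 4) : ℝ) : EReal) := by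
  obtain ⟨tA, tB, tC⟩ := ht
  have xA : 0 < B + C - A := by linarith
  have xB : 0 < A + C - B := by linarith
  have xC : 0 < A + B - C := by linarith
  set D := ((B + C - A) * A + (A + C - B) * B + (A + B - C) * C) / 4 with hD
  have hD0 : 0 < D := by positivity
  apply le_antisymm
  -- These weights solve ((a + c, c), (c, b + c)) = Σ⁻¹ for that covariance Σ. The exponents become
  -- aA, bB, cC, and p · s cancels against the logarithms in `youngConst`, leaving (n/2) log D.
  · set a := (B + C - A) / (2 * D) with ha
    set b := (A + C - B) / (2 * D) with hb
    set c := (A + B - C) / (2 * D) with hc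
    have ha0 : 0 < a := by positivity
    have hb0 : 0 < b := by positivity
    have hc0 : 0 < c := by positivity
    have hE : a * b + a * c + b * c = D⁻¹ := by
      have : (B + C - A) * (A + C - B) + (B + C - A) * (A + B - C) +
          (A + C - B) * (A + B - C) = 4 * D := by rw [hD]; ring
      calc _ = ((B + C - A) * (A + C - B) + (B + C - A) * (A + B - C) +
          (A + C - B) * (A + B - C)) / (4 * D ^ 2) := by rw [ha, hb, hc]; field_simp; ring
        _ = _ := by rw [this]; field_simp
    have hbc : (b + c) / D⁻¹ = A := by rw [hb, hc]; field_simp; ring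
    have hac : (a + c) / D⁻¹ = B := by rw [ha, hc]; field_simp; ring
    have hab : (a + b) / D⁻¹ = C := by rw [ha, hb]; field_simp; ring
    have hY := hasYoungBound_real ha0 hb0 hc0
    rw [youngConst, mul_div_assoc a, mul_div_assoc b, mul_div_assoc c, hE, hbc, hac, hab] at hY
    have hsum : a * A + b * B + c * C = 2 := by
      have : (B + C - A) * A + (A + C - B) * B + (A + B - C) * C = 4 * D := by rw [hD]; ring
      calc _ = ((B + C - A) * A + (A + C - B) * B + (A + B - C) * C) / (2 * D) := by
            rw [ha, hb, hc]; ring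
        _ = 2 := by rw [this]; field_simp; norm_num
    refine (phi_datumZero_le (p := ![a * A, b * B, c * C]) ?_ ?_ hY).trans ?_
    · intro i
      fin_cases i
      · exact (mul_pos ha0 hA).le
      · exact (mul_pos hb0 hB).le
      · exact (mul_pos hc0 hC).le
    · simpa [Fin.sum_univ_three] using hsum
    · rw [EReal.coe_le_coe_iff]
      apply le_of_eq
      simp [Fin.sum_univ_three, h0, h1, h2, Real.log_inv]
      ring
  · have hdet : A * B - ((C - A - B) / 2) ^ 2 = D := by rw [hD]; ring
    have hC' : A + B + 2 * ((C - A - B) / 2) = C := by ring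
    rw [← hdet]
    refine le_phi_datumZero hn hA (by rw [hdet]; exact hD0) fun i => ?_
    rw [hC']
    fin_cases i
    · simp [h0]
    · simp [h1]
    · simp [h2]

theorem log_div_two_mul_le {n : ℕ} {x y : ℝ} (hx : 0 < x) (h : x ≤ y) :
    (n : ℝ) / 2 * Real.log x ≤ (n : ℝ) / 2 * Real.log y :=
  mul_le_mul_of_nonneg_left (Real.log_le_log hx h) (by positivity)

/-- Each sum sᵢ + sⱼ is an upper bound by a degenerate Young inequality. If one of A, B, C is at
least the sum of the other two, a Gaussian with those two outputs independent gives the lower bound.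
-/
theorem phi_datumZero_eq_of_not_strictTriangle {n : ℕ} (hn : 0 < n) {s : Fin 3 → ℝ} {A B C : ℝ}
    (hA : 0 < A) (hB : 0 < B) (hC : 0 < C) (h0 : s 0 = (n : ℝ) / 2 * Real.log A)
    (h1 : s 1 = (n : ℝ) / 2 * Real.log B) (h2 : s 2 = (n : ℝ) / 2 * Real.log C)
    (ht : ¬ StrictTriangle A B C) :
    (datumZero n).phi s =
      ((min (s 0 + s 1) (min (s 0 + s 2) (s 1 + s 2)) : ℝ) : EReal) := by
  have hone : ENNReal.ofReal (Real.exp 0) = 1 := by simp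
  apply le_antisymm
  · have e1 : (datumZero n).phi s ≤ ((s 0 + s 1 : ℝ) : EReal) := by
      have := phi_datumZero_le (n := n) (p := ![1, 1, 0]) (s := s) (c := 0)
        (by intro i; fin_cases i <;> simp) (by simp [Fin.sum_univ_three]; norm_num)
        (by rw [hone]; exact hasYoungBound_one_one_zero ℝ)
      simpa [Fin.sum_univ_three] using this
    have e2 : (datumZero n).phi s ≤ ((s 0 + s 2 : ℝ) : EReal) := by
      have := phi_datumZero_le (n := n) (p := ![1, 0, 1]) (s := s) (c := 0)
        (by intro i; fin_cases i <;> simp) (by simp [Fin.sum_univ_three]; norm_num)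
        (by rw [hone]; exact hasYoungBound_one_zero_one ℝ)
      simpa [Fin.sum_univ_three] using this
    have e3 : (datumZero n).phi s ≤ ((s 1 + s 2 : ℝ) : EReal) := by
      have := phi_datumZero_le (n := n) (p := ![0, 1, 1]) (s := s) (c := 0)
        (by intro i; fin_cases i <;> simp) (by simp [Fin.sum_univ_three]; norm_num)
        (by rw [hone]; exact hasYoungBound_zero_one_one ℝ)
      simpa [Fin.sum_univ_three] using this
    rcases min_choice (s 0 + s 1) (min (s 0 + s 2) (s 1 + s 2)) with h | h
    · rw [h]; exact e1
    · rw [h]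
      rcases min_choice (s 0 + s 2) (s 1 + s 2) with h' | h' <;> rw [h']
      · exact e2
      · exact e3
  · have hlow : ∀ {α β γ t : ℝ}, 0 < α → 0 < α * β - γ ^ 2 →
        (n : ℝ) / 2 * Real.log (α * β - γ ^ 2) = t →
        (n : ℝ) / 2 * Real.log α ≤ s 0 → (n : ℝ) / 2 * Real.log β ≤ s 1 →
        (n : ℝ) / 2 * Real.log (α + β + 2 * γ) ≤ s 2 → ((t : ℝ) : EReal) ≤
          (datumZero n).phi s := by
      intro α β γ t hα hD ht a0 a1 a2
      rw [← ht]
      refine le_phi_datumZero hn hα hD fun i => ?_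
      fin_cases i
      · simpa using a0
      · simpa using a1
      · simpa using a2
    -- Here X₁ and X₂ are independent, so the third output has variance A + B ≤ C.
    by_cases hCc : A + B ≤ C
    · refine le_trans (EReal.coe_le_coe_iff.2 (min_le_left _ _)) ?_
      refine hlow (α := A) (β := B) (γ := 0) hA (by nlinarith [mul_pos hA hB]) ?_ h0.ge
        h1.ge ?_
      · rw [h0, h1, show A * B - 0 ^ 2 = A * B by ring, Real.log_mul hA.ne' hB.ne']
        ring
      · rw [h2]
        exact log_div_two_mul_le (by positivity) (by linarith)
    -- Here X₁ and X₁ + X₂ are independent with variances A and C, which forces covariance -A and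
    -- variance A + C for X₂.
    by_cases hBc : A + C ≤ B
    · refine le_trans (EReal.coe_le_coe_iff.2 ((min_le_right _ _).trans (min_le_left _ _))) ?_
      have hd : A * (A + C) - (-A) ^ 2 = A * C := by ring
      refine hlow (α := A) (β := A + C) (γ := -A) hA (by rw [hd]; positivity) ?_ h0.ge ?_ ?_
      · rw [h0, h2, hd, Real.log_mul hA.ne' hC.ne']
        ring
      · rw [h1]
        exact log_div_two_mul_le (by positivity) hBc
      · rw [h2, show A + (A + C) + 2 * -A = C by ring]
    -- The mirror case: X₂ and X₁ + X₂ are independent with variances B and C.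
    have hAc : B + C ≤ A := by
      by_contra h
      exact ht ⟨not_le.1 h, not_le.1 hBc, not_le.1 hCc⟩
    refine le_trans (EReal.coe_le_coe_iff.2 ((min_le_right _ _).trans (min_le_right _ _))) ?_
    have hd : (B + C) * B - (-B) ^ 2 = B * C := by ring
    refine hlow (α := B + C) (β := B) (γ := -B) (by positivity) (by rw [hd]; positivity) ?_ ?_
      h1.ge ?_
    · rw [h1, h2, hd, Real.log_mul hB.ne' hC.ne']
      ring
    · rw [h0]
      exact log_div_two_mul_le (by positivity) hAc
    · rw [h2, show B + C + B + 2 * -B = C by ring]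

theorem eq_half_mul_log_exp {n : ℕ} (hn : 0 < n) (s : ℝ) :
    s = (n : ℝ) / 2 * Real.log (Real.exp (2 * s / n)) := by
  have : (n : ℝ) ≠ 0 := Nat.cast_ne_zero.2 hn.ne'
  rw [Real.log_exp]
  field_simp

end Bounds

end BrascampLieb

theorem mainTheorem8 (n : ℕ) (hn : 0 < n) (s₁ s₂ s₃ : ℝ) :
    (BrascampLieb.StrictTriangle (Real.exp (2 * s₁ / n)) (Real.exp (2 * s₂ / n))
        (Real.exp (2 * s₃ / n)) →
      (BrascampLieb.datumZero n).phi ![s₁, s₂, s₃] =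
        (((n : ℝ) / 2 * Real.log
          (((Real.exp (2 * s₂ / n) + Real.exp (2 * s₃ / n) - Real.exp (2 * s₁ / n))
                * Real.exp (2 * s₁ / n)
            + (Real.exp (2 * s₁ / n) + Real.exp (2 * s₃ / n) - Real.exp (2 * s₂ / n))
                * Real.exp (2 * s₂ / n)
            + (Real.exp (2 * s₁ / n) + Real.exp (2 * s₂ / n) - Real.exp (2 * s₃ / n))
                * Real.exp (2 * s₃ / n)) / 4) : ℝ) : EReal)) ∧
    (¬ BrascampLieb.StrictTriangle (Real.exp (2 * s₁ / n)) (Real.exp (2 * s₂ / n))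
        (Real.exp (2 * s₃ / n)) →
      (BrascampLieb.datumZero n).phi ![s₁, s₂, s₃] =
        ((min (s₁ + s₂) (min (s₁ + s₃) (s₂ + s₃)) : ℝ) : EReal)) := by
  refine ⟨fun h => ?_, fun h => ?_⟩
  · exact BrascampLieb.phi_datumZero_eq_of_strictTriangle hn (Real.exp_pos _) (Real.exp_pos _)
      (Real.exp_pos _) (BrascampLieb.eq_half_mul_log_exp hn s₁)
      (BrascampLieb.eq_half_mul_log_exp hn s₂) (BrascampLieb.eq_half_mul_log_exp hn s₃) h
  · exact BrascampLieb.phi_datumZero_eq_of_not_strictTriangle hn (Real.exp_pos _) (Real.exp_pos _)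
      (Real.exp_pos _) (BrascampLieb.eq_half_mul_log_exp hn s₁)
      (BrascampLieb.eq_half_mul_log_exp hn s₂) (BrascampLieb.eq_half_mul_log_exp hn s₃) h
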